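/- Let $(M,g)$ be a non-empty smooth Riemannian manifold of dimension $n\ge 2$, with cotangent bundle $T^*M$ and induced local coordinates $(q^i,p_i)$ on $T^*M$. Let $\Gamma^k_{ij}$ be the Christoffel symbols of $g$, put $$\frac{\delta}{\delta q^i}=\frac{\partial}{\partial q^i}+p_k\Gamma^k_{ih}\frac{\partial}{\partial p_h},$$ and let $t=\frac12 g^{ij}p_ip_j$ be the energy density on $T^*M$. Let $A\neq 0$ be a real constant, let $0<\rho\le\infty$, and let $v:[0,\rho)\to\mathbb R$ be a smooth function with $A+2t\,v(t)\neq 0$ for all $t\in[0,\rho)$. Then the matrix with entries $G_{ij}=A\,g_{ij}+v(t)\,p_ip_j$ is invertible at every point of the tube $T^*_\rho M=\{p\in T^*M: t(p)<\rho\}$ (it is positive definite exactly when $A>0$ and $A+2tv>0$); let $(H^{ij})$ be its inverse. For $\rho=\infty$ the tube is all of $T^*M$. Let $J$ be the almost complex structure on $T^*_\rho M$ given by $$J\frac{\delta}{\delta q^i}=G_{ik}\frac{\partial}{\partial p_k},\qquad J\frac{\partial}{\partial p_i}=-H^{ik}\frac{\delta}{\delta q^k}.$$ Then $J$ is integrable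 on $T^*_\rho M$, that is, its Nijenhuis tensor $$N(X,Y)=[JX,JY]-J[JX,Y]-J[X,JY]-[X,Y]$$ vanishes identically there, if and only if there is a real number $c$ such that $(M,g)$ has constant sectional curvature $c$ and $v(t)=-\dfrac{c}{A}$ for all $t\in[0,\rho)$. -/

import Mathlib

open scoped Manifold ContDiff Bundle

set_option maxSynthPendingDepth 3

namespace CotangentACS

noncomputable section

variable {E : Type*} [NormedAddCommGroup E] [NormedSpace ℝ E]
variable {M : Type*} [TopologicalSpace M] [ChartedSpace E M] [IsManifold 𝓘(ℝ, E) ∞ M]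

/-- A smooth Riemannian metric on the smooth manifold `M`. -/
abbrev Metric (E : Type*) [NormedAddCommGroup E] [NormedSpace ℝ E]
    (M : Type*) [TopologicalSpace M] [ChartedSpace E M] [IsManifold 𝓘(ℝ, E) ∞ M] :=
  Bundle.ContMDiffRiemannianMetric 𝓘(ℝ, E) ∞ E (fun x : M => TangentSpace 𝓘(ℝ, E) x)

/-- The total space of the cotangent bundle `T*M`; a point is a pair `⟨x, p⟩` with `p` a linear
form on `T_x M`. Its manifold structure is Mathlib's one on the total space of a hom-bundle. -/
abbrev Cotangent (E : Type*) [NormedAddCommGroup E] [NormedSpace ℝ E]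
    (M : Type*) [TopologicalSpace M] [ChartedSpace E M] [IsManifold 𝓘(ℝ, E) ∞ M] :=
  Bundle.TotalSpace (E →L[ℝ] ℝ)
    (fun x : M => TangentSpace 𝓘(ℝ, E) x →L[ℝ] Bundle.Trivial M ℝ x)

/-- The model with corners of the manifold `T*M`. -/
abbrev cotModel (E : Type*) [NormedAddCommGroup E] [NormedSpace ℝ E] :
    ModelWithCorners ℝ (E × (E →L[ℝ] ℝ)) (ModelProd E (E →L[ℝ] ℝ)) :=
  𝓘(ℝ, E).prod 𝓘(ℝ, E →L[ℝ] ℝ)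

/-! ### Local coordinates on the base -/

/-- The local components `g_ij` of the metric in the chart of `M` centred at `x`, as a bilinear
form on `E` depending on the coordinates `y`. -/
def coordMetric (g : Metric E M) (x : M) (y : E) : E →L[ℝ] E →L[ℝ] ℝ :=
  let γ : E →L[ℝ] E →L[ℝ] ℝ := g.inner ((extChartAt 𝓘(ℝ, E) x).symm y)
  let dψ : E →L[ℝ] E := mfderiv 𝓘(ℝ, E) 𝓘(ℝ, E) (extChartAt 𝓘(ℝ, E) x).symm y
  γ.bilinearComp dψ dψ

/-- The Christoffel symbols of the first kind of a metric `γ` on (an open subset of) `E`: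
`(a, b, d) ↦ (∂_a γ(b, d) + ∂_b γ(a, d) - ∂_d γ(a, b)) / 2`. -/
def christoffelFirst (γ : E → E →L[ℝ] E →L[ℝ] ℝ) (y : E) : E →L[ℝ] E →L[ℝ] E →L[ℝ] ℝ :=
  (1 / 2 : ℝ) • (fderiv ℝ γ y + (fderiv ℝ γ y).flip -
    (ContinuousLinearMap.flipₗᵢ ℝ E E ℝ).toLinearIsometry.toContinuousLinearMap.comp
      (fderiv ℝ γ y).flip)

/-- The Christoffel symbols `Γ^k_ij` of a metric `γ` on (an open subset of) `E`, as the bilinear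
map `(a, b) ↦ Γ(a, b)`. -/
def christoffel (γ : E → E →L[ℝ] E →L[ℝ] ℝ) (y : E) : E →L[ℝ] E →L[ℝ] E :=
  (ContinuousLinearMap.compL ℝ E (E →L[ℝ] ℝ) E (γ y).inverse).comp (christoffelFirst γ y)

/-- The curvature tensor `R(a, b) c` of a metric `γ` on (an open subset of) `E`. -/
def coordCurvature (γ : E → E →L[ℝ] E →L[ℝ] ℝ) (y : E) (a b c : E) : E :=
  fderiv ℝ (christoffel γ) y a b c - fderiv ℝ (christoffel γ) y b a c
    + christoffel γ y a (christoffel γ y b c) - christoffel γ y b (christoffel γ y a c)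

/-! ### Sectional curvature -/

/-- The curvature tensor `R(X, Y) Z` of `(M, g)` at `x`, computed in the chart centred at `x`. -/
def curvature (g : Metric E M) (x : M) (X Y Z : TangentSpace 𝓘(ℝ, E) x) :
    TangentSpace 𝓘(ℝ, E) x :=
  let dφ : TangentSpace 𝓘(ℝ, E) x →L[ℝ] E :=
    mfderiv 𝓘(ℝ, E) 𝓘(ℝ, E) (extChartAt 𝓘(ℝ, E) x) x
  dφ.inverse
    (coordCurvature (coordMetric g x) (extChartAt 𝓘(ℝ, E) x x) (dφ X) (dφ Y) (dφ Z))

/-- The sectional curvature of the plane spanned by two linearly independent vectors. -/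
def sectionalCurvature (g : Metric E M) (x : M) (X Y : TangentSpace 𝓘(ℝ, E) x) : ℝ :=
  g.inner x (curvature g x X Y Y) X /
    (g.inner x X X * g.inner x Y Y - g.inner x X Y ^ 2)

/-- `(M, g)` has constant sectional curvature `c`. -/
def HasConstantSectionalCurvature (g : Metric E M) (c : ℝ) : Prop :=
  ∀ (x : M) (X Y : TangentSpace 𝓘(ℝ, E) x), LinearIndependent ℝ ![X, Y] →
    sectionalCurvature g x X Y = c

/-! ### The almost complex structure -/

/-- The energy density `t = g⁻¹(p, p) / 2` of a linear form `p` with respect to an inner product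
`γ` on `E`. -/
def coordEnergy (γ : E →L[ℝ] E →L[ℝ] ℝ) (p : E →L[ℝ] ℝ) : ℝ :=
  (1 / 2) * p (γ.inverse p)

/-- The components `G_ij = A g_ij + v(t) p_i p_j`, as a linear map from vectors to linear forms. -/
def coordG (A : ℝ) (v : ℝ → ℝ) (γ : E →L[ℝ] E →L[ℝ] ℝ) (p : E →L[ℝ] ℝ) : E →L[ℝ] E →L[ℝ] ℝ :=
  A • γ + v (coordEnergy γ p) • p.smulRight p

/-- `Γ^0_ih = p_k Γ^k_ih`, as a linear map from vectors to linear forms. -/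
def coordGammaZero (γ : E → E →L[ℝ] E →L[ℝ] ℝ) (z : E × (E →L[ℝ] ℝ)) : E →L[ℝ] E →L[ℝ] ℝ :=
  (ContinuousLinearMap.compL ℝ E E ℝ z.2).comp (christoffel γ z.1)

/-- The horizontal lift `a^i δ/δq^i`, where `δ/δq^i = ∂/∂q^i + Γ^0_ih ∂/∂p_h`. -/
def horizontal (γ : E → E →L[ℝ] E →L[ℝ] ℝ) (z : E × (E →L[ℝ] ℝ)) :
    E →L[ℝ] E × (E →L[ℝ] ℝ) :=
  (ContinuousLinearMap.id ℝ E).prod (coordGammaZero γ z)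

/-- The vertical lift `η_i ∂/∂p_i`. -/
def vertical : (E →L[ℝ] ℝ) →L[ℝ] E × (E →L[ℝ] ℝ) :=
  ContinuousLinearMap.inr ℝ E (E →L[ℝ] ℝ)

/-- The covariant differential `Dp_i = dp_i - Γ^0_ij dq^j`. -/
def covDiff (γ : E → E →L[ℝ] E →L[ℝ] ℝ) (z : E × (E →L[ℝ] ℝ)) :
    E × (E →L[ℝ] ℝ) →L[ℝ] (E →L[ℝ] ℝ) :=
  ContinuousLinearMap.snd ℝ E (E →L[ℝ] ℝ) -
    (coordGammaZero γ z).comp (ContinuousLinearMap.fst ℝ E (E →L[ℝ] ℝ))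

/-- The local expression of `J` at the point `z = (q, p)`:
`J δ/δq^i = G_ik ∂/∂p_k` and `J ∂/∂p_i = - H^ik δ/δq^k`, where `H` is the inverse of `G`. -/
def coordJ (A : ℝ) (v : ℝ → ℝ) (γ : E → E →L[ℝ] E →L[ℝ] ℝ) (z : E × (E →L[ℝ] ℝ)) :
    E × (E →L[ℝ] ℝ) →L[ℝ] E × (E →L[ℝ] ℝ) :=
  vertical.comp ((coordG A v (γ z.1) z.2).comp (ContinuousLinearMap.fst ℝ E (E →L[ℝ] ℝ))) -
    (horizontal γ z).comp ((coordG A v (γ z.1) z.2).inverse.comp (covDiff γ z))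

/-- The energy density `t = g⁻¹(p, p) / 2` on `T*M`. -/
def energy (g : Metric E M) (p : Cotangent E M) : ℝ :=
  (1 / 2) * p.2 ((g.inner p.1).inverse p.2)

/-- The tube `{t < ρ}` around the zero section of `T*M`; it is all of `T*M` for `ρ = ⊤`. -/
def tube (g : Metric E M) (ρ : EReal) : Set (Cotangent E M) :=
  {p | (energy g p : EReal) < ρ}

/-- The almost complex structure `J` on `T*M`: at the point `p`, it is the endomorphism of
`T_p (T*M)` with the local expression `coordJ` in the chart of `T*M` at `p`, which is the one
induced from the chart of `M` at the base point of `p`. -/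
def J (g : Metric E M) (A : ℝ) (v : ℝ → ℝ) (p : Cotangent E M) :
    TangentSpace (cotModel E) p →L[ℝ] TangentSpace (cotModel E) p :=
  let dΦ : TangentSpace (cotModel E) p →L[ℝ] E × (E →L[ℝ] ℝ) :=
    mfderiv (cotModel E) 𝓘(ℝ, E × (E →L[ℝ] ℝ)) (extChartAt (cotModel E) p) p
  dΦ.inverse.comp ((coordJ A v (coordMetric g p.1) (extChartAt (cotModel E) p p)).comp dΦ)

/-! ### Integrability -/

section Nijenhuis

variable {F : Type*} [NormedAddCommGroup F] [NormedSpace ℝ F]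
variable {H : Type*} [TopologicalSpace H] (I : ModelWithCorners ℝ F H)
variable {N : Type*} [TopologicalSpace N] [ChartedSpace H N] [IsManifold I 1 N]

/-- The Nijenhuis tensor `[JX, JY] - J[JX, Y] - J[X, JY] - [X, Y]` of a field of endomorphisms
of the tangent spaces of a manifold. -/
def nijenhuis (K : ∀ p : N, TangentSpace I p →L[ℝ] TangentSpace I p)
    (X Y : ∀ p : N, TangentSpace I p) (p : N) : TangentSpace I p :=
  VectorField.mlieBracket I (fun q => K q (X q)) (fun q => K q (Y q)) p
    - K p (VectorField.mlieBracket I (fun q => K q (X q)) Y p)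
    - K p (VectorField.mlieBracket I X (fun q => K q (Y q)) p)
    - VectorField.mlieBracket I X Y p

/-- Integrability on an open subset `D`, meaning that the Nijenhuis tensor vanishes there: it is
zero on all smooth vector fields defined on open subsets of `D`. -/
def IsIntegrableOn (K : ∀ p : N, TangentSpace I p →L[ℝ] TangentSpace I p) (D : Set N) : Prop :=
  ∀ U : Set N, IsOpen U → U ⊆ D → ∀ X Y : ∀ p : N, TangentSpace I p,
    ContMDiffOn I I.tangent ∞ (fun p => (⟨p, X p⟩ : TangentBundle I N)) U →
    ContMDiffOn I I.tangent ∞ (fun p => (⟨p, Y p⟩ : TangentBundle I N)) U →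
    ∀ p ∈ U, nijenhuis I K X Y p = 0

end Nijenhuis

end

end CotangentACS

/-!
Write `δ_a` for the horizontal lift of a vector `a`, so that `J δ_a` is the vertical vector `G_a`,
and `N` for the Nijenhuis tensor. Since `J² = -1`, `N` is conjugate linear over `J`, and the
`δ_a`, `J δ_a` span each tangent space; hence `N` vanishes as soon as all `N(δ_a, δ_b)` do.

The horizontal part of `N(δ_a, δ_b)` is zero because `G` is built from `g` and `t`, which are
parallel along horizontal lifts, and because the Levi-Civita connection is torsion free. In the
vertical part, the terms with the derivative of `v` are symmetric in `a` and `b` and cancel, which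
leaves (`IsLocalMetric.nijenhuisTensor_horizontal`)
`A v(t) (p(b) g(a, c) - p(a) g(b, c)) - p(R(a, b) c)`.
So `J` is integrable if and only if `p(R(a, b) c) = A v(t) (p(b) g(a, c) - p(a) g(b, c))` at all
covectors `p` of the tube (`isIntegrableOn_iff_curvature`).

If this identity holds, then rescaling `p` shows that `v` is constant on `(0, ρ)`, as the other
factors are linear in `p` and do not all vanish in dimension at least two; by continuity `v` is
constant on `[0, ρ)` (`profile_const`), and the identity becomes
`R(a, b) c = -A v (g(b, c) a - g(a, c) b)`. Conversely, constant sectional curvature gives `R` this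
form, because an algebraic curvature tensor is determined by its sectional curvatures
(`IsLocalMetric.coordCurvature_eq_of_sectional`).

At each point `J` is defined in the chart at that point, while brackets have to be computed in
one fixed chart. The bridge is that `coordJ` is natural under changes of coordinates
(`coordJ_natural`), by the transformation law of the Christoffel symbols (`christoffel_pullback`).
-/

namespace CotangentACS

open Filter Topology VectorField

variable {E : Type*} [NormedAddCommGroup E] [NormedSpace ℝ E]

/-! ### Metrics on open subsets of a vector space -/

/-- `γ` is a smooth Riemannian metric on the open set `O` of the vector space `E`. -/
structure IsLocalMetric (γ : E → E →L[ℝ] E →L[ℝ] ℝ) (O : Set E) : Prop where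
  isOpen : IsOpen O
  contDiffOn : ContDiffOn ℝ ∞ γ O
  symm : ∀ y ∈ O, ∀ a b, γ y a b = γ y b a
  pos : ∀ y ∈ O, ∀ a, a ≠ 0 → 0 < γ y a a

/-- On a finite-dimensional space, a nondegenerate bilinear form is invertible. -/
theorem isInvertible_of_nondegenerate [FiniteDimensional ℝ E] (β : E →L[ℝ] E →L[ℝ] ℝ)
    (h : ∀ a, β a = 0 → a = 0) : β.IsInvertible := by
  have hfin : Module.finrank ℝ E = Module.finrank ℝ (E →L[ℝ] ℝ) := by
    rw [← (LinearMap.toContinuousLinearMap (𝕜 := ℝ) (E := E) (F' := ℝ)).finrank_eq]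
    exact (Subspace.dual_finrank_eq (K := ℝ) (V := E)).symm
  have hinj : Function.Injective (β : E →ₗ[ℝ] (E →L[ℝ] ℝ)) :=
    (injective_iff_map_eq_zero _).2 h
  refine ⟨(LinearEquiv.ofInjectiveOfFinrankEq (β : E →ₗ[ℝ] (E →L[ℝ] ℝ)) hinj
    hfin).toContinuousLinearEquiv, ?_⟩
  ext a b
  rfl

theorem isInvertible_of_pos [FiniteDimensional ℝ E] {β : E →L[ℝ] E →L[ℝ] ℝ}
    (h : ∀ a, a ≠ 0 → 0 < β a a) : β.IsInvertible := by
  refine isInvertible_of_nondegenerate β fun a ha => ?_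
  by_contra hne
  simpa [ha] using h a hne

theorem christoffelFirst_apply (γ : E → E →L[ℝ] E →L[ℝ] ℝ) (y a b d : E) :
    christoffelFirst γ y a b d =
      (1 / 2) * (fderiv ℝ γ y a b d + fderiv ℝ γ y b a d - fderiv ℝ γ y d a b) := by
  simp [christoffelFirst]

/-- The derivative of `x ↦ β_x(f x, h x)`. -/
theorem fderiv_bilin_apply {X : Type*} [NormedAddCommGroup X] [NormedSpace ℝ X]
    {β : X → E →L[ℝ] E →L[ℝ] ℝ} {β' : X →L[ℝ] E →L[ℝ] E →L[ℝ] ℝ}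
    {f h : X → E} {f' h' : X →L[ℝ] E} {x : X} (hβ : HasFDerivAt β β' x)
    (hf : HasFDerivAt f f' x) (hh : HasFDerivAt h h' x) (w : X) :
    fderiv ℝ (fun x => β x (f x) (h x)) x w =
      β' w (f x) (h x) + β x (f' w) (h x) + β x (f x) (h' w) := by
  rw [((hβ.clm_apply hf).clm_apply hh).fderiv]
  simp
  ring

theorem coordCurvature_swap (γ : E → E →L[ℝ] E →L[ℝ] ℝ) (y a b c : E) :
    coordCurvature γ y a b c = -coordCurvature γ y b a c := by
  simp only [coordCurvature]
  abel

omit [NormedSpace ℝ E] in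
/-- An algebraic curvature tensor with vanishing sectional curvatures vanishes. -/
theorem eq_zero_of_sectional_eq_zero (S : E → E → E → E → ℝ)
    (add₁ : ∀ a a' b d e, S (a + a') b d e = S a b d e + S a' b d e)
    (add₃ : ∀ a b d d' e, S a b (d + d') e = S a b d e + S a b d' e)
    (swap₁₂ : ∀ a b d e, S a b d e = -S b a d e) (swap₃₄ : ∀ a b d e, S a b d e = -S a b e d)
    (bianchi : ∀ a b d e, S a b d e + S b d a e + S d a b e = 0)
    (h : ∀ a b, S a b b a = 0) (a b d e : E) : S a b d e = 0 := by
  have pair : ∀ a b d e, S a b d e = S d e a b := fun a b d e => by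
    linarith [bianchi a b d e, bianchi b d e a, bianchi d e a b, bianchi e a b d,
      swap₃₄ b d a e, swap₃₄ d a b e, swap₃₄ d e b a, swap₃₄ e b d a, swap₃₄ e a d b,
      swap₃₄ a d e b, swap₃₄ a b e d, swap₃₄ b e a d, swap₁₂ d a b e, swap₁₂ e b d a,
      swap₁₂ e a d b, swap₁₂ b e a d, swap₁₂ a d b e, swap₁₂ b d a e, swap₁₂ d e a b,
      swap₁₂ a b d e, swap₃₄ a d b e, swap₁₂ d e b a, swap₁₂ b d e a, swap₁₂ e a b d,
      swap₁₂ b e d a, swap₃₄ d e a b, swap₃₄ b e d a]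
  -- polarize in the middle arguments
  have h1 : ∀ a b d, S a b d a = 0 := fun a b d => by
    have := h a (b + d)
    rw [add₃, swap₁₂ a (b + d) b, swap₁₂ a (b + d) d, add₁, add₁] at this
    linarith [h a b, h a d, pair a d b a, swap₁₂ b a a d, swap₃₄ a b a d, swap₁₂ b a b a,
      swap₁₂ d a b a, swap₁₂ b a d a, swap₁₂ d a d a]
  -- polarize in the outer arguments
  have h2 : ∀ a b d e, S a b d e = -S e b d a := fun a b d e => by
    have := h1 (a + e) b d
    rw [add₁, swap₃₄ a b d (a + e), swap₃₄ e b d (a + e), add₃, add₃] at this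
    linarith [h1 a b d, h1 e b d, swap₃₄ a b a d, swap₃₄ a b e d, swap₃₄ e b a d, swap₃₄ e b e d]
  -- so `S` is invariant under cyclic permutations, and the Bianchi identity says `3 S = 0`
  have h3 : ∀ a b d e, S a b d e = S d a b e := fun a b d e => by
    linarith [h2 a b d e, pair e b d a, swap₁₂ d a e b, swap₃₄ a d e b, swap₁₂ d a b e]
  linarith [bianchi a b d e, h3 a b d e, h3 d a b e]

namespace IsLocalMetric

variable {γ : E → E →L[ℝ] E →L[ℝ] ℝ} {O : Set E} (hγ : IsLocalMetric γ O)
include hγ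

theorem mem_nhds {y : E} (hy : y ∈ O) : O ∈ 𝓝 y := hγ.isOpen.mem_nhds hy

theorem contDiffAt {y : E} (hy : y ∈ O) : ContDiffAt ℝ ∞ γ y :=
  hγ.contDiffOn.contDiffAt (hγ.mem_nhds hy)

theorem hasFDerivAt {y : E} (hy : y ∈ O) : HasFDerivAt γ (fderiv ℝ γ y) y :=
  ((hγ.contDiffAt hy).differentiableAt (by simp)).hasFDerivAt

theorem fderiv_symm {y : E} (hy : y ∈ O) (a b c : E) :
    fderiv ℝ γ y a b c = fderiv ℝ γ y a c b := by
  have h : (fun y => γ y b c) =ᶠ[𝓝 y] fun y => γ y c b := by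
    filter_upwards [hγ.mem_nhds hy] with z hz using hγ.symm z hz b c
  have h' := congrArg (fun L : E →L[ℝ] _ => L a) h.fderiv_eq
  simpa [fderiv_bilin_apply (hγ.hasFDerivAt hy) (hasFDerivAt_const b y)
    (hasFDerivAt_const c y), fderiv_bilin_apply (hγ.hasFDerivAt hy) (hasFDerivAt_const c y)
    (hasFDerivAt_const b y)] using h'

variable [FiniteDimensional ℝ E]

theorem isInvertible {y : E} (hy : y ∈ O) : (γ y).IsInvertible :=
  isInvertible_of_pos (hγ.pos y hy)

theorem injective {y : E} (hy : y ∈ O) {a b : E} (h : ∀ d, γ y a d = γ y b d) : a = b :=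
  (hγ.isInvertible hy).injective (ContinuousLinearMap.ext h)

/-- Lowering the index of `Γ^k_ij` gives the Christoffel symbols of the first kind. -/
theorem apply_christoffel {y : E} (hy : y ∈ O) (a b d : E) :
    γ y (christoffel γ y a b) d = christoffelFirst γ y a b d := by
  simp [christoffel, (hγ.isInvertible hy).self_apply_inverse]

/-- The Levi-Civita connection is torsion free. -/
theorem christoffel_symm {y : E} (hy : y ∈ O) (a b : E) :
    christoffel γ y a b = christoffel γ y b a := by
  refine hγ.injective hy fun d => ?_
  rw [hγ.apply_christoffel hy, hγ.apply_christoffel hy, christoffelFirst_apply,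
    christoffelFirst_apply, hγ.fderiv_symm hy d a b]
  ring

/-- The Levi-Civita connection is compatible with the metric. -/
theorem fderiv_eq {y : E} (hy : y ∈ O) (a b c : E) :
    fderiv ℝ γ y a b c = γ y (christoffel γ y a b) c + γ y b (christoffel γ y a c) := by
  rw [hγ.symm y hy b, hγ.apply_christoffel hy, hγ.apply_christoffel hy, christoffelFirst_apply,
    christoffelFirst_apply, hγ.fderiv_symm hy a c b, hγ.fderiv_symm hy c a b,
    hγ.fderiv_symm hy b a c]
  ring

theorem contDiffAt_inverse {y : E} (hy : y ∈ O) :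
    ContDiffAt ℝ ∞ (fun y => (γ y).inverse) y := by
  have := FiniteDimensional.complete ℝ E
  exact (hγ.isInvertible hy).contDiffAt_map_inverse.comp y (hγ.contDiffAt hy)

set_option synthInstance.maxHeartbeats 200000 in
theorem contDiffAt_christoffel {y : E} (hy : y ∈ O) : ContDiffAt ℝ ∞ (christoffel γ) y := by
  have h1 : ContDiffAt ℝ ∞ (fderiv ℝ γ) y := (hγ.contDiffAt hy).fderiv_right le_rfl
  have h2 : ContDiffAt ℝ ∞ (fun y => (fderiv ℝ γ y).flip) y :=
    (ContinuousLinearMap.flipₗᵢ ℝ E E (E →L[ℝ] ℝ)).toContinuousLinearEquiv.contDiff.contDiffAt.comp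
      y h1
  have h3 : ContDiffAt ℝ ∞ (christoffelFirst γ) y :=
    ((h1.add h2).sub (contDiffAt_const.clm_comp h2)).const_smul _
  exact ((ContinuousLinearMap.compL ℝ E (E →L[ℝ] ℝ) E).contDiff.contDiffAt.comp y
    (hγ.contDiffAt_inverse hy)).clm_comp h3

theorem hasFDerivAt_christoffel {y : E} (hy : y ∈ O) :
    HasFDerivAt (christoffel γ) (fderiv ℝ (christoffel γ) y) y :=
  ((hγ.contDiffAt_christoffel hy).differentiableAt (by simp)).hasFDerivAt

theorem hasFDerivAt_christoffel_apply {y : E} (hy : y ∈ O) (b c : E) :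
    HasFDerivAt (fun y => christoffel γ y b c)
      (((fderiv ℝ (christoffel γ) y).flip b).flip c) y := by
  refine (((hγ.hasFDerivAt_christoffel hy).clm_apply (hasFDerivAt_const b y)).clm_apply
    (hasFDerivAt_const c y)).congr_fderiv ?_
  ext w
  simp

theorem fderiv_christoffel_symm {y : E} (hy : y ∈ O) (a b c : E) :
    fderiv ℝ (christoffel γ) y a b c = fderiv ℝ (christoffel γ) y a c b := by
  have h : (fun y => christoffel γ y b c) =ᶠ[𝓝 y] fun y => christoffel γ y c b := by
    filter_upwards [hγ.mem_nhds hy] with z hz using hγ.christoffel_symm hz b c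
  have h' := congrArg (fun L : E →L[ℝ] _ => L a) h.fderiv_eq
  have key := hγ.hasFDerivAt_christoffel_apply hy
  simpa [(key b c).fderiv, (key c b).fderiv] using h'

/-! ### Symmetries of the curvature tensor -/

/-- The first Bianchi identity. -/
theorem coordCurvature_bianchi {y : E} (hy : y ∈ O) (a b c : E) :
    coordCurvature γ y a b c + coordCurvature γ y b c a + coordCurvature γ y c a b = 0 := by
  simp only [coordCurvature]
  rw [hγ.fderiv_christoffel_symm hy a c b, hγ.fderiv_christoffel_symm hy b c a,
    hγ.fderiv_christoffel_symm hy c b a, hγ.christoffel_symm hy c b, hγ.christoffel_symm hy c a,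
    hγ.christoffel_symm hy b a]
  abel

/-- The curvature operator `R(a, b)` is skew-adjoint: this expresses that second derivatives of
the metric commute. -/
theorem coordCurvature_skew {y : E} (hy : y ∈ O) (a b c d : E) :
    γ y (coordCurvature γ y a b c) d = -γ y (coordCurvature γ y a b d) c := by
  have hΓ := hγ.hasFDerivAt_christoffel_apply hy
  have hd : HasFDerivAt (fderiv ℝ γ) (fderiv ℝ (fderiv ℝ γ) y) y :=
    (((hγ.contDiffAt hy).fderiv_right (m := ∞) le_rfl).differentiableAt (by simp)).hasFDerivAt
  have key : ∀ a b, fderiv ℝ (fderiv ℝ γ) y a b c d =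
      γ y (christoffel γ y a (christoffel γ y b c)) d
      + γ y (christoffel γ y b c) (christoffel γ y a d)
      + γ y (fderiv ℝ (christoffel γ) y a b c) d
      + γ y (christoffel γ y a c) (christoffel γ y b d)
      + γ y c (christoffel γ y a (christoffel γ y b d))
      + γ y c (fderiv ℝ (christoffel γ) y a b d) := by
    intro a b
    have h : (fun y => fderiv ℝ γ y b c d) =ᶠ[𝓝 y] fun y =>
        γ y (christoffel γ y b c) d + γ y c (christoffel γ y b d) := by
      filter_upwards [hγ.mem_nhds hy] with z hz using hγ.fderiv_eq hz b c d
    have h' := congrArg (fun L : E →L[ℝ] _ => L a) h.fderiv_eq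
    have hdb : HasFDerivAt (fun y => fderiv ℝ γ y b) ((fderiv ℝ (fderiv ℝ γ) y).flip b) y := by
      refine (hd.clm_apply (hasFDerivAt_const b y)).congr_fderiv ?_
      ext w; simp
    have e1 := fderiv_bilin_apply hdb (hasFDerivAt_const c y) (hasFDerivAt_const d y) a
    have e2 := fderiv_bilin_apply (hγ.hasFDerivAt hy) (hΓ b c) (hasFDerivAt_const d y) a
    have e3 := fderiv_bilin_apply (hγ.hasFDerivAt hy) (hasFDerivAt_const c y) (hΓ b d) a
    have dγ := (hγ.hasFDerivAt hy).differentiableAt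
    have e4 := fderiv_add (𝕜 := ℝ) (x := y)
      ((dγ.clm_apply (hΓ b c).differentiableAt).clm_apply (differentiableAt_const d))
      ((dγ.clm_apply (differentiableAt_const c)).clm_apply (hΓ b d).differentiableAt)
    simp only [Pi.add_def] at e4
    beta_reduce at h'
    rw [e1, e4, add_apply, e2, e3] at h'
    simp at h'
    rw [h', hγ.fderiv_eq hy, hγ.fderiv_eq hy]
    ring
  have hs : fderiv ℝ (fderiv ℝ γ) y a b = fderiv ℝ (fderiv ℝ γ) y b a :=
    ((hγ.contDiffAt hy).isSymmSndFDerivAt (by simpa using ENat.LEInfty.out)).eq a b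
  have h1 := key a b
  rw [hs, key b a] at h1
  rw [hγ.symm y hy (coordCurvature γ y a b d)]
  simp only [coordCurvature, map_add, map_sub, add_apply, sub_apply]
  linarith

/-- If all sectional curvatures at a point are equal to `c`, the curvature tensor there is
`R(a, b) d = c (g(b, d) a - g(a, d) b)`: an algebraic curvature tensor is determined by its
sectional curvatures. -/
theorem coordCurvature_eq_of_sectional {y : E} (hy : y ∈ O) {c : ℝ}
    (h : ∀ a b, LinearIndependent ℝ ![a, b] →
      γ y (coordCurvature γ y a b b) a = c * (γ y a a * γ y b b - γ y a b ^ 2)) (a b d : E) :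
    coordCurvature γ y a b d = c • (γ y b d • a - γ y a d • b) := by
  have hsub : ∀ (a b d e : E), γ y (coordCurvature γ y a b d) e
      - c * (γ y b d * γ y a e - γ y a d * γ y b e) = 0 := by
    refine eq_zero_of_sectional_eq_zero _ ?_ ?_ ?_ ?_ ?_ ?_
    · intro a a' b d e
      simp only [coordCurvature, map_add, map_sub, add_apply, sub_apply]
      ring
    · intro a b d d' e
      simp only [coordCurvature, map_add, map_sub, add_apply, sub_apply]
      ring
    · intro a b d e
      rw [coordCurvature_swap, map_neg, neg_apply]
      ring
    · intro a b d e
      rw [hγ.coordCurvature_skew hy]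
      ring
    · intro a b d e
      have h0 := congrArg (fun w => γ y w e) (hγ.coordCurvature_bianchi hy a b d)
      simp only [map_add, add_apply, map_zero, zero_apply] at h0
      rw [hγ.symm y hy d a, hγ.symm y hy d b, hγ.symm y hy b a]
      linarith
    · intro a b
      by_cases hab : LinearIndependent ℝ ![a, b]
      · rw [h a b hab, hγ.symm y hy b a]
        ring
      · -- on dependent vectors both sides vanish by skew-symmetry
        by_cases ha : a = 0
        · simp [ha, coordCurvature]
        · rw [LinearIndependent.pair_iff' ha] at hab
          push Not at hab
          obtain ⟨r, rfl⟩ := hab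
          simp only [coordCurvature, map_smul, map_add, map_sub, smul_apply, add_apply, sub_apply,
            smul_eq_mul]
          ring
  refine hγ.injective hy fun e => ?_
  simp only [map_smul, map_sub, smul_apply, sub_apply, smul_eq_mul]
  linarith [hsub a b d e]

end IsLocalMetric

/-! ### The Nijenhuis tensor of a field of endomorphisms of a vector space -/

section NijenhuisTensor

variable {F : Type*} [NormedAddCommGroup F] [NormedSpace ℝ F]

/-- The value at `z` on the vectors `x`, `y` of the Nijenhuis tensor of an almost complex
structure `K` on a vector space, expressed through the derivative of `K`. -/
noncomputable def nijenhuisTensor (K : F → F →L[ℝ] F) (z x y : F) : F :=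
  fderiv ℝ K z (K z x) y - fderiv ℝ K z (K z y) x
    + K z (fderiv ℝ K z y x) - K z (fderiv ℝ K z x y)

variable {K : F → F →L[ℝ] F} {z : F}

/-- The Nijenhuis bracket expression is tensorial: the derivatives of the fields cancel. -/
theorem nijenhuis_lieBracket_eq (hK : DifferentiableAt ℝ K z) (hsq : ∀ x, K z (K z x) = -x)
    {X Y : F → F} (hX : DifferentiableAt ℝ X z) (hY : DifferentiableAt ℝ Y z) :
    lieBracket ℝ (fun u => K u (X u)) (fun u => K u (Y u)) z
      - K z (lieBracket ℝ (fun u => K u (X u)) Y z)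
      - K z (lieBracket ℝ X (fun u => K u (Y u)) z) - lieBracket ℝ X Y z =
    nijenhuisTensor K z (X z) (Y z) := by
  have h : ∀ {V : F → F}, DifferentiableAt ℝ V z → ∀ w,
      fderiv ℝ (fun u => K u (V u)) z w = K z (fderiv ℝ V z w) + fderiv ℝ K z w (V z) := by
    intro V hV w
    rw [(hK.hasFDerivAt.clm_apply hV.hasFDerivAt).fderiv]
    simp
  simp only [lieBracket, h hX, h hY, nijenhuisTensor, map_sub, map_add, hsq]
  abel

theorem nijenhuisTensor_swap (K : F → F →L[ℝ] F) (z x y : F) :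
    nijenhuisTensor K z x y = -nijenhuisTensor K z y x := by
  simp only [nijenhuisTensor]
  abel

theorem nijenhuisTensor_add_left (K : F → F →L[ℝ] F) (z x x' y : F) :
    nijenhuisTensor K z (x + x') y = nijenhuisTensor K z x y + nijenhuisTensor K z x' y := by
  simp only [nijenhuisTensor, map_add, add_apply]
  abel

/-- The Nijenhuis tensor is conjugate linear over `K`. -/
theorem nijenhuisTensor_apply_left (hK : DifferentiableAt ℝ K z)
    (hsq : ∀ᶠ u in 𝓝 z, ∀ x, K u (K u x) = -x) (x y : F) :
    nijenhuisTensor K z (K z x) y = -K z (nijenhuisTensor K z x y) := by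
  have h0 := hsq.self_of_nhds
  have hd : ∀ w x, fderiv ℝ K z w (K z x) = -K z (fderiv ℝ K z w x) := by
    intro w x
    have hc := hK.hasFDerivAt.clm_apply (hK.hasFDerivAt.clm_apply (hasFDerivAt_const x z))
    have he : (fun u => K u (K u x)) =ᶠ[𝓝 z] fun _ => -x := by
      filter_upwards [hsq] with u hu using hu x
    have := congrArg (fun L : F →L[ℝ] F => L w) (hc.fderiv.symm.trans he.fderiv_eq)
    simp at this
    exact eq_neg_of_add_eq_zero_right this
  simp only [nijenhuisTensor, h0, hd, map_neg, map_add, map_sub, neg_apply]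
  abel

end NijenhuisTensor


/-! ### The almost complex structure in coordinates -/

/-- The assumptions on the coefficients `A` and `v` over the tube of radius `ρ`. -/
structure IsProfile (A : ℝ) (v : ℝ → ℝ) (ρ : EReal) : Prop where
  ne_zero : A ≠ 0
  contDiffOn : ContDiffOn ℝ ∞ v {t : ℝ | 0 ≤ t ∧ (t : EReal) < ρ}
  add_ne_zero : ∀ t : ℝ, 0 ≤ t → (t : EReal) < ρ → A + 2 * t * v t ≠ 0

/-- The part of the tube `{t < ρ}` over the coordinate domain `O`. -/
def localTube (γ : E → E →L[ℝ] E →L[ℝ] ℝ) (O : Set E) (ρ : EReal) : Set (E × (E →L[ℝ] ℝ)) :=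
  {z | z.1 ∈ O ∧ (coordEnergy (γ z.1) z.2 : EReal) < ρ}

section Frame

variable (γ : E → E →L[ℝ] E →L[ℝ] ℝ) (A : ℝ) (v : ℝ → ℝ) (z w : E × (E →L[ℝ] ℝ))

theorem coordG_apply (β : E →L[ℝ] E →L[ℝ] ℝ) (p : E →L[ℝ] ℝ) (a b : E) :
    coordG A v β p a b = A * β a b + v (coordEnergy β p) * (p a * p b) := by
  simp [coordG]

theorem coordGammaZero_apply (a b : E) :
    coordGammaZero γ z a b = z.2 (christoffel γ z.1 a b) := by
  simp [coordGammaZero]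

theorem covDiff_apply : covDiff γ z w = w.2 - coordGammaZero γ z w.1 := by
  simp [covDiff]

theorem covDiff_coordJ :
    covDiff γ z (coordJ A v γ z w) = coordG A v (γ z.1) z.2 w.1 := by
  simp [covDiff, coordJ, vertical, horizontal]
  abel

theorem coordJ_fst :
    (coordJ A v γ z w).1 = -(coordG A v (γ z.1) z.2).inverse (covDiff γ z w) := by
  simp [coordJ, vertical, horizontal]

theorem horizontal_eq : horizontal γ = fun z => ContinuousLinearMap.inl ℝ E (E →L[ℝ] ℝ)
    + (ContinuousLinearMap.inr ℝ E (E →L[ℝ] ℝ)).comp (coordGammaZero γ z) := by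
  funext z
  refine ContinuousLinearMap.ext fun a => ?_
  simp [horizontal]

theorem coordJ_horizontal (a : E) :
    coordJ A v γ z (horizontal γ z a) = (0, coordG A v (γ z.1) z.2 a) := by
  simp [covDiff, coordJ, vertical, horizontal]

variable {γ z w} in
/-- A tangent vector is determined by its components in the adapted coframe `(dq, Dp)`. -/
theorem ext_covDiff {w' : E × (E →L[ℝ] ℝ)} (h1 : w.1 = w'.1)
    (h2 : covDiff γ z w = covDiff γ z w') : w = w' := by
  refine Prod.ext h1 ?_
  rw [covDiff_apply, covDiff_apply, h1] at h2
  exact sub_left_injective h2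

variable {γ A v z} in
theorem coordJ_coordJ (h : (coordG A v (γ z.1) z.2).IsInvertible) :
    coordJ A v γ z (coordJ A v γ z w) = -w := by
  refine ext_covDiff (γ := γ) (z := z) ?_ ?_
  · rw [coordJ_fst, covDiff_coordJ, h.inverse_apply_self]
    rfl
  · rw [covDiff_coordJ, coordJ_fst, map_neg, h.self_apply_inverse, map_neg]

end Frame

namespace IsLocalMetric

variable [FiniteDimensional ℝ E] {γ : E → E →L[ℝ] E →L[ℝ] ℝ} {O : Set E}
  (hγ : IsLocalMetric γ O) {z : E × (E →L[ℝ] ℝ)}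
include hγ

theorem apply_inverse_apply {y : E} (hy : y ∈ O) (p : E →L[ℝ] ℝ) (a : E) :
    γ y a ((γ y).inverse p) = p a := by
  rw [hγ.symm y hy, (hγ.isInvertible hy).self_apply_inverse]

theorem coordEnergy_nonneg {y : E} (hy : y ∈ O) (p : E →L[ℝ] ℝ) : 0 ≤ coordEnergy (γ y) p := by
  rw [coordEnergy, ← hγ.apply_inverse_apply hy]
  rcases eq_or_ne ((γ y).inverse p) 0 with h | h
  · simp [h]
  · have := hγ.pos y hy _ h
    positivity

theorem contDiffAt_sharp (hz : z.1 ∈ O) :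
    ContDiffAt ℝ ∞ (fun z : E × (E →L[ℝ] ℝ) => (γ z.1).inverse z.2) z :=
  ((hγ.contDiffAt_inverse hz).comp z contDiffAt_fst).clm_apply contDiffAt_snd

theorem contDiffAt_coordEnergy (hz : z.1 ∈ O) :
    ContDiffAt ℝ ∞ (fun z : E × (E →L[ℝ] ℝ) => coordEnergy (γ z.1) z.2) z :=
  contDiffAt_const.mul (contDiffAt_snd.clm_apply (hγ.contDiffAt_sharp hz))

/-- The derivative of the energy density `t`. -/
theorem fderiv_coordEnergy (hz : z.1 ∈ O) (w : E × (E →L[ℝ] ℝ)) :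
    fderiv ℝ (fun z : E × (E →L[ℝ] ℝ) => coordEnergy (γ z.1) z.2) z w =
      w.2 ((γ z.1).inverse z.2)
        - 1 / 2 * fderiv ℝ γ z.1 w.1 ((γ z.1).inverse z.2) ((γ z.1).inverse z.2) := by
  set s : E × (E →L[ℝ] ℝ) → E := fun z => (γ z.1).inverse z.2 with hs
  have ds : HasFDerivAt s (fderiv ℝ s z) z :=
    ((hγ.contDiffAt_sharp hz).differentiableAt (by simp)).hasFDerivAt
  -- differentiate both `p(s)` and `g(s, s)`, where `s` is the vector dual to `p`
  have e1 : fderiv ℝ (fun z : E × (E →L[ℝ] ℝ) => z.2 (s z)) z w =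
      z.2 (fderiv ℝ s z w) + w.2 (s z) := by
    rw [(hasFDerivAt_snd.clm_apply ds).fderiv]
    simp
  have e2 := fderiv_bilin_apply ((hγ.hasFDerivAt hz).comp z hasFDerivAt_fst) ds ds w
  have e3 : (fun z : E × (E →L[ℝ] ℝ) => z.2 (s z)) =ᶠ[𝓝 z] fun z => γ z.1 (s z) (s z) := by
    filter_upwards [continuousAt_fst (hγ.mem_nhds hz)] with u hu
    rw [hγ.apply_inverse_apply hu]
  have e4 : fderiv ℝ (fun z : E × (E →L[ℝ] ℝ) => coordEnergy (γ z.1) z.2) z w =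
      1 / 2 * fderiv ℝ (fun z : E × (E →L[ℝ] ℝ) => z.2 (s z)) z w := by
    simp only [coordEnergy]
    rw [fderiv_const_mul ((hasFDerivAt_snd.clm_apply ds).differentiableAt)]
    simp
  have e5 : fderiv ℝ (fun z : E × (E →L[ℝ] ℝ) => z.2 (s z)) z w = _ :=
    (congrArg (fun L : (E × (E →L[ℝ] ℝ)) →L[ℝ] ℝ => L w) e3.fderiv_eq).trans e2
  simp only [ContinuousLinearMap.comp_apply, ContinuousLinearMap.coe_fst', Function.comp_apply]
    at e5
  rw [hγ.symm z.1 hz (s z)] at e5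
  simp only [hs] at e1 e5 e4 ⊢
  rw [hγ.apply_inverse_apply hz] at e5
  linarith

variable {ρ : EReal} {A : ℝ} {v : ℝ → ℝ}

theorem isOpen_localTube : IsOpen (localTube γ O ρ) := by
  rw [isOpen_iff_mem_nhds]
  rintro z ⟨hz, hlt⟩
  have hc := continuous_coe_real_ereal.continuousAt.comp (hγ.contDiffAt_coordEnergy hz).continuousAt
  filter_upwards [continuousAt_fst (hγ.mem_nhds hz), hc.eventually_lt_const hlt] with u h1 h2
    using ⟨h1, h2⟩

/-- `G` is invertible: on a vector of its kernel, evaluating at the vector dual to `p` gives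
`(A + 2 t v(t)) p(a) = 0`. -/
theorem isInvertible_coordG (hv : IsProfile A v ρ) (hz : z ∈ localTube γ O ρ) :
    (coordG A v (γ z.1) z.2).IsInvertible := by
  refine isInvertible_of_nondegenerate _ fun a ha => ?_
  set s := (γ z.1).inverse z.2 with hs
  have hps : z.2 s = 2 * coordEnergy (γ z.1) z.2 := by
    simp only [coordEnergy, ← hs]
    ring
  have h1 : (A + 2 * coordEnergy (γ z.1) z.2 * v (coordEnergy (γ z.1) z.2)) * z.2 a = 0 := by
    have := congrArg (fun q : E →L[ℝ] ℝ => q s) ha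
    simp only [coordG_apply, zero_apply, hps] at this
    rw [hγ.apply_inverse_apply hz.1] at this
    linarith
  have h2 : z.2 a = 0 :=
    (mul_eq_zero.1 h1).resolve_left (hv.add_ne_zero _ (hγ.coordEnergy_nonneg hz.1 _) hz.2)
  refine hγ.injective hz.1 fun d => ?_
  have := congrArg (fun q : E →L[ℝ] ℝ => q d) ha
  simpa [coordG_apply, h2, hv.ne_zero] using this

theorem contDiffAt_profile (hv : IsProfile A v ρ) (hz : z ∈ localTube γ O ρ) :
    ContDiffAt ℝ ∞ (fun z : E × (E →L[ℝ] ℝ) => v (coordEnergy (γ z.1) z.2)) z := by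
  have h : ContDiffOn ℝ ∞ (fun z : E × (E →L[ℝ] ℝ) => coordEnergy (γ z.1) z.2)
      (localTube γ O ρ) := fun u hu => (hγ.contDiffAt_coordEnergy hu.1).contDiffWithinAt
  exact (hv.contDiffOn.comp h fun u hu => ⟨hγ.coordEnergy_nonneg hu.1 _, hu.2⟩).contDiffAt
    (hγ.isOpen_localTube.mem_nhds hz)

/-- The derivative of `v(t)` is a multiple of that of `t`, also where `t = 0` is an end point of the
interval on which `v` is smooth. -/
theorem exists_fderiv_profile (hv : IsProfile A v ρ) (hz : z ∈ localTube γ O ρ) :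
    ∃ v' : ℝ, ∀ w, fderiv ℝ (fun z : E × (E →L[ℝ] ℝ) => v (coordEnergy (γ z.1) z.2)) z w =
      v' * fderiv ℝ (fun z : E × (E →L[ℝ] ℝ) => coordEnergy (γ z.1) z.2) z w := by
  have hd := ((hv.contDiffOn.differentiableOn (by simp)) _
    ⟨hγ.coordEnergy_nonneg hz.1 z.2, hz.2⟩).hasDerivWithinAt
  have he := ((hγ.contDiffAt_coordEnergy hz.1).differentiableAt (by simp)).hasFDerivAt
  have hm : Set.MapsTo (fun z : E × (E →L[ℝ] ℝ) => coordEnergy (γ z.1) z.2) (localTube γ O ρ)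
      {t : ℝ | 0 ≤ t ∧ (t : EReal) < ρ} := fun u hu => ⟨hγ.coordEnergy_nonneg hu.1 _, hu.2⟩
  have hc := (hd.comp_hasFDerivWithinAt z he.hasFDerivWithinAt hm).hasFDerivAt
    (hγ.isOpen_localTube.mem_nhds hz)
  have := hc.fderiv
  simp only [Function.comp_def] at this
  exact ⟨_, fun w => by rw [this, smul_apply, smul_eq_mul]⟩

set_option synthInstance.maxHeartbeats 200000 in
theorem contDiffAt_coordG (hv : IsProfile A v ρ) (hz : z ∈ localTube γ O ρ) :
    ContDiffAt ℝ ∞ (fun z : E × (E →L[ℝ] ℝ) => coordG A v (γ z.1) z.2) z := by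
  have h1 : ContDiffAt ℝ ∞ (fun z : E × (E →L[ℝ] ℝ) => A • γ z.1) z :=
    ((hγ.contDiffAt hz.1).comp z contDiffAt_fst).const_smul A
  have h2 : ContDiffAt ℝ ∞ (fun z : E × (E →L[ℝ] ℝ) => z.2.smulRight z.2) z :=
    contDiffAt_snd.smulRight contDiffAt_snd
  exact h1.add ((hγ.contDiffAt_profile hv hz).smul h2)

theorem contDiffAt_coordGammaZero (hz : z.1 ∈ O) :
    ContDiffAt ℝ ∞ (coordGammaZero γ) z :=
  ((ContinuousLinearMap.compL ℝ E E ℝ).contDiff.contDiffAt.comp z contDiffAt_snd).clm_comp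
    ((hγ.contDiffAt_christoffel hz).comp z contDiffAt_fst)

theorem contDiffAt_coordJ (hv : IsProfile A v ρ) (hz : z ∈ localTube γ O ρ) :
    ContDiffAt ℝ ∞ (coordJ A v γ) z := by
  have := FiniteDimensional.complete ℝ E
  have hΓ := hγ.contDiffAt_coordGammaZero hz.1
  have hG := hγ.contDiffAt_coordG hv hz
  have hH : ContDiffAt ℝ ∞ (fun z : E × (E →L[ℝ] ℝ) => (coordG A v (γ z.1) z.2).inverse) z :=
    ContDiffAt.comp (g := ContinuousLinearMap.inverse) z
      (hγ.isInvertible_coordG hv hz).contDiffAt_map_inverse hG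
  have hcov : ContDiffAt ℝ ∞ (covDiff γ) z :=
    contDiffAt_const.sub (hΓ.clm_comp contDiffAt_const)
  have hhor : ContDiffAt ℝ ∞ (fun z => ContinuousLinearMap.inl ℝ E (E →L[ℝ] ℝ)
      + (ContinuousLinearMap.inr ℝ E (E →L[ℝ] ℝ)).comp (coordGammaZero γ z)) z :=
    contDiffAt_const.add (contDiffAt_const.clm_comp hΓ)
  rw [← horizontal_eq] at hhor
  exact (contDiffAt_const.clm_comp (hG.clm_comp contDiffAt_const)).sub
    (hhor.clm_comp (hH.clm_comp hcov))

/-- The derivative of the components `G_ij`. -/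
theorem exists_fderiv_coordG (hv : IsProfile A v ρ) (hz : z ∈ localTube γ O ρ) :
    ∃ v' : ℝ, ∀ (w : E × (E →L[ℝ] ℝ)) (b c : E),
      fderiv ℝ (fun z : E × (E →L[ℝ] ℝ) => coordG A v (γ z.1) z.2) z w b c =
        A * fderiv ℝ γ z.1 w.1 b c
          + v' * (w.2 ((γ z.1).inverse z.2)
            - 1 / 2 * fderiv ℝ γ z.1 w.1 ((γ z.1).inverse z.2) ((γ z.1).inverse z.2))
            * (z.2 b * z.2 c)
          + v (coordEnergy (γ z.1) z.2) * (w.2 b * z.2 c + z.2 b * w.2 c) := by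
  obtain ⟨v', hv'⟩ := hγ.exists_fderiv_profile hv hz
  refine ⟨v', fun w b c => ?_⟩
  have hG := ((hγ.contDiffAt_coordG hv hz).differentiableAt (by simp)).hasFDerivAt
  have e1 := fderiv_bilin_apply hG (hasFDerivAt_const b z) (hasFDerivAt_const c z) w
  have dv := ((hγ.contDiffAt_profile hv hz).differentiableAt (by simp)).hasFDerivAt
  have dg := (((hγ.hasFDerivAt hz.1).comp z hasFDerivAt_fst).clm_apply
    (hasFDerivAt_const b z)).clm_apply (hasFDerivAt_const c z)
  have dp : ∀ b : E, HasFDerivAt (fun z : E × (E →L[ℝ] ℝ) => z.2 b) _ z := fun b =>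
    hasFDerivAt_snd.clm_apply (hasFDerivAt_const b z)
  have e2 := ((dg.const_mul A).add (dv.mul ((dp b).mul (dp c)))).fderiv
  simp only [coordG_apply] at e1
  have e3 := e1.symm.trans (congrArg (fun L : (E × (E →L[ℝ] ℝ)) →L[ℝ] ℝ => L w) e2)
  simp at e3
  rw [e3, hv', hγ.fderiv_coordEnergy hz.1]
  ring

end IsLocalMetric

namespace IsLocalMetric

variable [FiniteDimensional ℝ E] {γ : E → E →L[ℝ] E →L[ℝ] ℝ} {O : Set E}
  (hγ : IsLocalMetric γ O) {z : E × (E →L[ℝ] ℝ)} {ρ : EReal} {A : ℝ} {v : ℝ → ℝ}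
include hγ

/-! ### The Nijenhuis tensor on horizontal vectors -/

/-- The tensor `G_ij` is parallel along horizontal lifts, because `g` is parallel and the energy
density `t` is constant along them. -/
theorem fderiv_coordG_horizontal (hv : IsProfile A v ρ) (hz : z ∈ localTube γ O ρ) (a b c : E) :
    fderiv ℝ (fun z : E × (E →L[ℝ] ℝ) => coordG A v (γ z.1) z.2) z (horizontal γ z a) b c =
      coordG A v (γ z.1) z.2 (christoffel γ z.1 a b) c
        + coordG A v (γ z.1) z.2 b (christoffel γ z.1 a c) := by
  obtain ⟨v', hv'⟩ := hγ.exists_fderiv_coordG hv hz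
  rw [hv']
  simp only [horizontal, ContinuousLinearMap.prod_apply, ContinuousLinearMap.id_apply,
    coordGammaZero_apply, hγ.fderiv_eq hz.1, hγ.apply_inverse_apply hz.1, coordG_apply]
  rw [hγ.symm _ hz.1 ((γ z.1).inverse z.2), hγ.apply_inverse_apply hz.1]
  ring

/-- The vertical derivative of `G_ij` in the direction of a covector `G_a`; the terms with the
derivative of `v` are symmetric in `a` and `b`, so that they disappear here. -/
theorem fderiv_coordG_vertical_sub (hv : IsProfile A v ρ) (hz : z ∈ localTube γ O ρ) (a b c : E) :
    fderiv ℝ (fun z : E × (E →L[ℝ] ℝ) => coordG A v (γ z.1) z.2) z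
        (0, coordG A v (γ z.1) z.2 a) b c
      - fderiv ℝ (fun z : E × (E →L[ℝ] ℝ) => coordG A v (γ z.1) z.2) z
        (0, coordG A v (γ z.1) z.2 b) a c =
      A * v (coordEnergy (γ z.1) z.2) * (z.2 b * γ z.1 a c - z.2 a * γ z.1 b c) := by
  obtain ⟨v', hv'⟩ := hγ.exists_fderiv_coordG hv hz
  rw [hv', hv']
  simp only [coordG_apply, map_zero, zero_apply, hγ.apply_inverse_apply hz.1]
  rw [hγ.symm _ hz.1 b a]
  ring

theorem fderiv_horizontal (hz : z.1 ∈ O) (b : E) (w : E × (E →L[ℝ] ℝ)) :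
    DifferentiableAt ℝ (fun z => horizontal γ z b) z ∧
    fderiv ℝ (fun z => horizontal γ z b) z w =
      (0, w.2.comp (christoffel γ z.1 b) + z.2.comp (fderiv ℝ (christoffel γ) z.1 w.1 b)) := by
  have h1 := ((hγ.hasFDerivAt_christoffel hz).comp z hasFDerivAt_fst).clm_apply
    (hasFDerivAt_const b z)
  have h2 := (hasFDerivAt_const b z).prodMk (hasFDerivAt_snd.clm_comp h1)
  have he : (fun z => horizontal γ z b) =
      fun z : E × (E →L[ℝ] ℝ) => (b, z.2.comp (christoffel γ z.1 b)) := by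
    funext z
    refine Prod.ext rfl (ContinuousLinearMap.ext fun c => ?_)
    simp [horizontal, coordGammaZero_apply]
  rw [he]
  refine ⟨h2.differentiableAt, ?_⟩
  have := h2.fderiv
  simp only [Function.comp_def] at this
  rw [this]
  refine Prod.ext (by simp) (ContinuousLinearMap.ext fun c => ?_)
  simp [add_comm]

theorem fderiv_vertical (hv : IsProfile A v ρ) (hz : z ∈ localTube γ O ρ) (b : E)
    (w : E × (E →L[ℝ] ℝ)) :
    fderiv ℝ (fun z : E × (E →L[ℝ] ℝ) => ((0 : E), coordG A v (γ z.1) z.2 b)) z w =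
      (0, fderiv ℝ (fun z : E × (E →L[ℝ] ℝ) => coordG A v (γ z.1) z.2) z w b) := by
  have hG := ((hγ.contDiffAt_coordG hv hz).differentiableAt (by simp)).hasFDerivAt
  rw [((hasFDerivAt_const (0 : E) z).prodMk (hG.clm_apply (hasFDerivAt_const b z))).fderiv]
  simp

theorem coordJ_sq_eventually (hv : IsProfile A v ρ) (hz : z ∈ localTube γ O ρ) :
    ∀ᶠ u in 𝓝 z, ∀ x, coordJ A v γ u (coordJ A v γ u x) = -x := by
  filter_upwards [hγ.isOpen_localTube.mem_nhds hz] with u hu x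
    using coordJ_coordJ (w := x) (hγ.isInvertible_coordG hv hu)

theorem differentiableAt_coordJ (hv : IsProfile A v ρ) (hz : z ∈ localTube γ O ρ) :
    DifferentiableAt ℝ (coordJ A v γ) z :=
  (hγ.contDiffAt_coordJ hv hz).differentiableAt (by simp)

/-- On two horizontal lifts the Nijenhuis tensor of `J` is vertical, and compares the curvature of
`g` with a tensor built from `g`, `p` and `v(t)`. -/
theorem nijenhuisTensor_horizontal (hv : IsProfile A v ρ) (hz : z ∈ localTube γ O ρ) (a b : E) :
    (nijenhuisTensor (coordJ A v γ) z (horizontal γ z a) (horizontal γ z b)).1 = 0 ∧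
    ∀ c, (nijenhuisTensor (coordJ A v γ) z (horizontal γ z a) (horizontal γ z b)).2 c =
      A * v (coordEnergy (γ z.1) z.2) * (z.2 b * γ z.1 a c - z.2 a * γ z.1 b c)
        - z.2 (coordCurvature γ z.1 a b c) := by
  have hd := fun b => (hγ.fderiv_horizontal hz.1 b 0).1
  have hN := nijenhuis_lieBracket_eq (hγ.differentiableAt_coordJ hv hz)
    (hγ.coordJ_sq_eventually hv hz).self_of_nhds (hd a) (hd b)
  rw [← hN]
  simp only [coordJ_horizontal, lieBracket, hγ.fderiv_vertical hv hz,
    (hγ.fderiv_horizontal hz.1 _ _).2]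
  -- the brackets of horizontal with vertical fields contribute only through their sum
  have hmix : ∀ X₁ X₂ Y₁ Y₂ P Q : E × (E →L[ℝ] ℝ), X₁ - X₂ + (Y₁ - Y₂) = 0 →
      P - coordJ A v γ z (X₁ - X₂) - coordJ A v γ z (Y₁ - Y₂) - Q = P - Q := by
    intro X₁ X₂ Y₁ Y₂ P Q h
    rw [sub_sub P, ← map_add, h, map_zero, sub_zero]
  rw [hmix]
  · refine ⟨by simp, fun c => ?_⟩
    have := hγ.fderiv_coordG_vertical_sub hv hz a b c
    simp [horizontal, coordGammaZero_apply, coordCurvature] at this ⊢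
    linarith
  · refine Prod.ext (by simp) (ContinuousLinearMap.ext fun c => ?_)
    have h1 := hγ.fderiv_coordG_horizontal hv hz a b c
    have h2 := hγ.fderiv_coordG_horizontal hv hz b a c
    rw [hγ.christoffel_symm hz.1 b a] at h2
    simp [horizontal] at h1 h2 ⊢
    linarith

/-- The Nijenhuis tensor of `J` vanishes at `(q, p)` if and only if
`p(R(a, b) c) = A v(t) (p(b) g(a, c) - p(a) g(b, c))`. -/
theorem nijenhuisTensor_eq_zero_iff (hv : IsProfile A v ρ) (hz : z ∈ localTube γ O ρ) :
    (∀ x y, nijenhuisTensor (coordJ A v γ) z x y = 0) ↔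
      ∀ a b c, z.2 (coordCurvature γ z.1 a b c) =
        A * v (coordEnergy (γ z.1) z.2) * (z.2 b * γ z.1 a c - z.2 a * γ z.1 b c) := by
  have hhor := hγ.nijenhuisTensor_horizontal hv hz
  constructor
  · intro h a b c
    have := (hhor a b).2 c
    rw [h] at this
    simp at this
    linarith
  · intro h
    have hzero : ∀ a b,
        nijenhuisTensor (coordJ A v γ) z (horizontal γ z a) (horizontal γ z b) = 0 := by
      intro a b
      refine Prod.ext (hhor a b).1 (ContinuousLinearMap.ext fun c => ?_)
      rw [(hhor a b).2, h]
      simp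
    -- every tangent vector is the sum of a horizontal one and the image under `J` of another
    have hdec : ∀ x, ∃ a a', x = horizontal γ z a + coordJ A v γ z (horizontal γ z a') := by
      intro x
      refine ⟨x.1, (coordG A v (γ z.1) z.2).inverse (covDiff γ z x),
        ext_covDiff (γ := γ) (z := z) ?_ ?_⟩
      · rw [coordJ_horizontal]
        simp [horizontal]
      · rw [coordJ_horizontal, (hγ.isInvertible_coordG hv hz).self_apply_inverse, map_add]
        simp [covDiff_apply, horizontal]
    have hJ := fun x y => nijenhuisTensor_apply_left (hγ.differentiableAt_coordJ hv hz)
      (hγ.coordJ_sq_eventually hv hz) x y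
    have hleft : ∀ x b, nijenhuisTensor (coordJ A v γ) z x (horizontal γ z b) = 0 := by
      intro x b
      obtain ⟨a, a', rfl⟩ := hdec x
      rw [nijenhuisTensor_add_left, hJ, hzero, hzero]
      simp
    intro x y
    obtain ⟨b, b', rfl⟩ := hdec y
    rw [nijenhuisTensor_swap, nijenhuisTensor_add_left, hJ, nijenhuisTensor_swap _ _ _ x,
      nijenhuisTensor_swap _ _ _ x, hleft, hleft]
    simp

end IsLocalMetric

/-! ### Change of coordinates -/

section ChangeOfCoordinates

variable [FiniteDimensional ℝ E] {γ₁ γ₂ : E → E →L[ℝ] E →L[ℝ] ℝ} {O₁ O₂ : Set E} {τ : E → E}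

omit [FiniteDimensional ℝ E] in
/-- The energy density does not depend on the coordinates. -/
theorem coordEnergy_comp {β₁ β₂ : E →L[ℝ] E →L[ℝ] ℝ} (h₁ : β₁.IsInvertible) (h₂ : β₂.IsInvertible)
    {L : E →L[ℝ] E} (hL : Function.Surjective L) (h : ∀ a b, β₁ a b = β₂ (L a) (L b))
    {p q : E →L[ℝ] ℝ} (hpq : q.comp L = p) : coordEnergy β₁ p = coordEnergy β₂ q := by
  have hs : L (β₁.inverse p) = β₂.inverse q := by
    refine h₂.injective (ContinuousLinearMap.ext fun c' => ?_)
    obtain ⟨c, rfl⟩ := hL c'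
    rw [← h, h₁.self_apply_inverse, h₂.self_apply_inverse, ← hpq]
    rfl
  rw [coordEnergy, coordEnergy, ← hs, ← hpq]
  rfl

/-- The transformation law of the Christoffel symbols. -/
theorem christoffel_pullback (h₁ : IsLocalMetric γ₁ O₁) (h₂ : IsLocalMetric γ₂ O₂) {y : E}
    (hy : y ∈ O₁) (hτy : τ y ∈ O₂) (hτ : ContDiffAt ℝ ∞ τ y)
    (hsurj : Function.Surjective (fderiv ℝ τ y))
    (hpull : ∀ᶠ u in 𝓝 y, ∀ a b, γ₁ u a b = γ₂ (τ u) (fderiv ℝ τ u a) (fderiv ℝ τ u b))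
    (a b : E) :
    fderiv ℝ τ y (christoffel γ₁ y a b) =
      fderiv ℝ (fderiv ℝ τ) y a b
        + christoffel γ₂ (τ y) (fderiv ℝ τ y a) (fderiv ℝ τ y b) := by
  have dτ : HasFDerivAt τ (fderiv ℝ τ y) y := (hτ.differentiableAt (by simp)).hasFDerivAt
  have ddτ : HasFDerivAt (fderiv ℝ τ) (fderiv ℝ (fderiv ℝ τ) y) y :=
    ((hτ.fderiv_right (m := ∞) le_rfl).differentiableAt (by simp)).hasFDerivAt
  have hs : ∀ a b, fderiv ℝ (fderiv ℝ τ) y a b = fderiv ℝ (fderiv ℝ τ) y b a :=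
    fun a b => (hτ.isSymmSndFDerivAt (by simpa using ENat.LEInfty.out)).eq a b
  have key : ∀ a b d, fderiv ℝ γ₁ y a b d =
      fderiv ℝ γ₂ (τ y) (fderiv ℝ τ y a) (fderiv ℝ τ y b) (fderiv ℝ τ y d)
      + γ₂ (τ y) (fderiv ℝ (fderiv ℝ τ) y a b) (fderiv ℝ τ y d)
      + γ₂ (τ y) (fderiv ℝ τ y b) (fderiv ℝ (fderiv ℝ τ) y a d) := by
    intro a b d
    have he : (fun u => γ₁ u b d) =ᶠ[𝓝 y]
        fun u => γ₂ (τ u) (fderiv ℝ τ u b) (fderiv ℝ τ u d) := by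
      filter_upwards [hpull] with u hu using hu b d
    have e1 := fderiv_bilin_apply (h₁.hasFDerivAt hy) (hasFDerivAt_const b y)
      (hasFDerivAt_const d y) a
    have e2 := fderiv_bilin_apply ((h₂.hasFDerivAt hτy).comp y dτ)
      (ddτ.clm_apply (hasFDerivAt_const b y)) (ddτ.clm_apply (hasFDerivAt_const d y)) a
    have e3 := congrArg (fun L : E →L[ℝ] ℝ => L a) he.fderiv_eq
    simp only [Function.comp_def] at e2
    have e4 := (e1.symm.trans e3).trans e2
    simpa using e4
  refine h₂.injective hτy fun d' => ?_
  obtain ⟨d, rfl⟩ := hsurj d'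
  rw [map_add, add_apply, h₂.apply_christoffel hτy, ← hpull.self_of_nhds,
    h₁.apply_christoffel hy, christoffelFirst_apply, christoffelFirst_apply, key, key, key,
    hs b a, hs d a, hs d b, h₂.symm _ hτy (fderiv ℝ τ y b) (fderiv ℝ (fderiv ℝ τ) y a d)]
  linarith [h₂.symm _ hτy (fderiv ℝ τ y a) (fderiv ℝ (fderiv ℝ τ) y b d)]

/-- Under a change of coordinates `q ↦ τ(q)`, `p ↦ p ∘ (dτ)⁻¹`, the coordinate expressions of `J`
correspond to each other. -/
theorem coordJ_natural {ρ : EReal} {A : ℝ} {v : ℝ → ℝ} (hv : IsProfile A v ρ)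
    (h₁ : IsLocalMetric γ₁ O₁) (h₂ : IsLocalMetric γ₂ O₂)
    {T : E × (E →L[ℝ] ℝ) → E × (E →L[ℝ] ℝ)} {z : E × (E →L[ℝ] ℝ)}
    (hz : z ∈ localTube γ₁ O₁ ρ) (hτz : τ z.1 ∈ O₂) (hτ : ContDiffAt ℝ ∞ τ z.1)
    (hT : DifferentiableAt ℝ T z)
    (hinv : Function.Surjective (fderiv ℝ τ z.1))
    (hpull : ∀ᶠ u in 𝓝 z.1, ∀ a b, γ₁ u a b = γ₂ (τ u) (fderiv ℝ τ u a) (fderiv ℝ τ u b))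
    (hT₁ : ∀ᶠ u in 𝓝 z, (T u).1 = τ u.1)
    (hT₂ : ∀ᶠ u in 𝓝 z, (T u).2.comp (fderiv ℝ τ u.1) = u.2)
    (w : E × (E →L[ℝ] ℝ)) :
    fderiv ℝ T z (coordJ A v γ₁ z w) = coordJ A v γ₂ (T z) (fderiv ℝ T z w) := by
  have dτ : HasFDerivAt τ (fderiv ℝ τ z.1) z.1 := (hτ.differentiableAt (by simp)).hasFDerivAt
  have ddτ : HasFDerivAt (fderiv ℝ τ) (fderiv ℝ (fderiv ℝ τ) z.1) z.1 :=
    ((hτ.fderiv_right (m := ∞) le_rfl).differentiableAt (by simp)).hasFDerivAt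
  have hTz₁ : (T z).1 = τ z.1 := hT₁.self_of_nhds
  have hE : coordEnergy (γ₁ z.1) z.2 = coordEnergy (γ₂ (T z).1) (T z).2 := by
    rw [hTz₁]
    exact coordEnergy_comp (h₁.isInvertible hz.1) (h₂.isInvertible hτz) hinv hpull.self_of_nhds
      hT₂.self_of_nhds
  have hTz : T z ∈ localTube γ₂ O₂ ρ := ⟨hTz₁ ▸ hτz, hE ▸ hz.2⟩
  have hpz : ∀ c, (T z).2 (fderiv ℝ τ z.1 c) = z.2 c := fun c =>
    congrArg (fun q : E →L[ℝ] ℝ => q c) hT₂.self_of_nhds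
  have fst_eq : ∀ w, (fderiv ℝ T z w).1 = fderiv ℝ τ z.1 w.1 := by
    intro w
    have := (hT.hasFDerivAt.fst.fderiv.symm.trans (Filter.EventuallyEq.fderiv_eq hT₁)).trans
      (dτ.comp z hasFDerivAt_fst).fderiv
    simpa using congrArg (fun L : (E × (E →L[ℝ] ℝ)) →L[ℝ] E => L w) this
  have snd_eq : ∀ w c, (fderiv ℝ T z w).2 (fderiv ℝ τ z.1 c)
      + (T z).2 (fderiv ℝ (fderiv ℝ τ) z.1 w.1 c) = w.2 c := by
    intro w c
    have e1 := (hT.hasFDerivAt.snd.clm_comp (ddτ.comp z hasFDerivAt_fst)).fderiv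
    have := (e1.symm.trans (Filter.EventuallyEq.fderiv_eq hT₂)).trans hasFDerivAt_snd.fderiv
    have h' := congrArg (fun L : (E × (E →L[ℝ] ℝ)) →L[ℝ] (E →L[ℝ] ℝ) => L w c) this
    simp at h'
    linarith
  have cov_eq : ∀ w c, covDiff γ₂ (T z) (fderiv ℝ T z w) (fderiv ℝ τ z.1 c) =
      covDiff γ₁ z w c := by
    intro w c
    have hΓ := christoffel_pullback h₁ h₂ hz.1 hτz hτ hinv hpull w.1 c
    have h3 := congrArg (T z).2 hΓ
    rw [hpz, map_add] at h3
    simp only [covDiff_apply, sub_apply, coordGammaZero_apply, fst_eq, hTz₁]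
    linarith [snd_eq w c]
  have G_eq : ∀ a c, coordG A v (γ₂ (T z).1) (T z).2 (fderiv ℝ τ z.1 a) (fderiv ℝ τ z.1 c) =
      coordG A v (γ₁ z.1) z.2 a c := by
    intro a c
    rw [coordG_apply, coordG_apply, ← hE, hpz, hpz, hpull.self_of_nhds, hTz₁]
  refine ext_covDiff (γ := γ₂) (z := T z) ?_ ?_
  · -- compare the images under the invertible map `G`
    refine (h₂.isInvertible_coordG hv hTz).injective ?_
    refine ContinuousLinearMap.ext fun c' => ?_
    obtain ⟨c, rfl⟩ := hinv c'
    rw [fst_eq, coordJ_fst, coordJ_fst, map_neg, map_neg, map_neg,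
      (h₂.isInvertible_coordG hv hTz).self_apply_inverse, neg_apply, neg_apply, G_eq,
      (h₁.isInvertible_coordG hv hz).self_apply_inverse, cov_eq]
  · refine ContinuousLinearMap.ext fun c' => ?_
    obtain ⟨c, rfl⟩ := hinv c'
    rw [cov_eq, covDiff_coordJ, covDiff_coordJ, fst_eq, G_eq]

end ChangeOfCoordinates

variable {M : Type*} [TopologicalSpace M] [ChartedSpace E M] [IsManifold 𝓘(ℝ, E) ∞ M]

/-! ### The metric in the charts of the manifold -/

/-- The derivative at `y` of the inverse of the chart of `M` centred at `x`; the tangent space of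
`M` at the image point is identified with the model space `E`. -/
noncomputable def chartSymmDeriv (x : M) (y : E) : E →L[ℝ] E :=
  mfderiv 𝓘(ℝ, E) 𝓘(ℝ, E) (extChartAt 𝓘(ℝ, E) x).symm y

omit [IsManifold 𝓘(ℝ, E) ∞ M] in
theorem extChartAt_target_mem_nhds_of_mem {x : M} {y : E}
    (hy : y ∈ (extChartAt 𝓘(ℝ, E) x).target) : (extChartAt 𝓘(ℝ, E) x).target ∈ 𝓝 y :=
  (isOpen_extChartAt_target x).mem_nhds hy

theorem contMDiffAt_extChartAt_symm {x : M} {y : E} (hy : y ∈ (extChartAt 𝓘(ℝ, E) x).target) :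
    ContMDiffAt 𝓘(ℝ, E) 𝓘(ℝ, E) ∞ (extChartAt 𝓘(ℝ, E) x).symm y :=
  (contMDiffOn_extChartAt_symm x).contMDiffAt (extChartAt_target_mem_nhds_of_mem hy)

theorem isInvertible_chartSymmDeriv {x : M} {y : E} (hy : y ∈ (extChartAt 𝓘(ℝ, E) x).target) :
    (chartSymmDeriv x y).IsInvertible := by
  have h := isInvertible_mfderivWithin_extChartAt_symm (I := 𝓘(ℝ, E)) hy
  rw [modelWithCornersSelf_coe, Set.range_id, mfderivWithin_univ] at h
  exact h

theorem symmL_trivializationAt_eq {x x' : M} (hx : x' ∈ (extChartAt 𝓘(ℝ, E) x).source) :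
    (trivializationAt E (TangentSpace 𝓘(ℝ, E)) x).symmL ℝ x' =
      chartSymmDeriv x (extChartAt 𝓘(ℝ, E) x x') := by
  have h := TangentBundle.symmL_trivializationAt (I := 𝓘(ℝ, E)) (x₀ := x) (x := x')
    (by rwa [extChartAt_source] at hx)
  rw [modelWithCornersSelf_coe, Set.range_id, mfderivWithin_univ] at h
  exact h

theorem coordMetric_apply (g : Metric E M) (x : M) (y a b : E) :
    coordMetric g x y a b = g.inner ((extChartAt 𝓘(ℝ, E) x).symm y)
      (chartSymmDeriv x y a) (chartSymmDeriv x y b) := rfl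

/-- The chart expression of a Riemannian metric is a local metric. -/
theorem isLocalMetric_coordMetric (g : Metric E M) (x : M) :
    IsLocalMetric (coordMetric g x) (extChartAt 𝓘(ℝ, E) x).target where
  isOpen := isOpen_extChartAt_target x
  contDiffOn := by
    intro y hy
    refine ContDiffAt.contDiffWithinAt ?_
    set φ := extChartAt 𝓘(ℝ, E) x with hφ
    have hx' : φ.symm y ∈ φ.source := φ.map_target hy
    have h1 := (Bundle.Trivialization.contMDiffAt_section_iff
      (trivializationAt (E →L[ℝ] E →L[ℝ] ℝ)
        (fun x : M => TangentSpace 𝓘(ℝ, E) x →L[ℝ] TangentSpace 𝓘(ℝ, E) x →L[ℝ] ℝ) x)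
      (x₀ := φ.symm y) (by simpa [hφ] using hx')).1 (g.contMDiff (φ.symm y))
    have h2 := (h1.comp y (contMDiffAt_extChartAt_symm hy)).contDiffAt
    refine h2.congr_of_eventuallyEq ?_
    filter_upwards [extChartAt_target_mem_nhds_of_mem hy] with u hu
    have hu' : φ.symm u ∈ φ.source := φ.map_target hu
    refine ContinuousLinearMap.ext fun a => ContinuousLinearMap.ext fun b => ?_
    have hs : chartSymmDeriv x u =
        (trivializationAt E (TangentSpace 𝓘(ℝ, E)) x).symmL ℝ (φ.symm u) := by
      rw [symmL_trivializationAt_eq hu', φ.right_inv hu]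
    have hb : φ.symm u ∈ (trivializationAt E (TangentSpace 𝓘(ℝ, E)) x).baseSet := by
      simpa [hφ] using hu'
    have key := inCoordinates_apply_eq₂ (F₃ := ℝ) (E₃ := Bundle.Trivial M ℝ)
      (ϕ := g.inner (φ.symm u)) (v := a) (w := b) hb hb (Set.mem_univ _)
    simp only [Bundle.Trivial.fiberBundle_trivializationAt',
      Bundle.Trivial.linearMapAt_trivialization, LinearMap.id_coe, id_eq] at key
    rw [← Bundle.Trivialization.symmL_apply (R := ℝ) _ hb,
      ← Bundle.Trivialization.symmL_apply (R := ℝ) _ hb] at key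
    rw [coordMetric_apply, hs]
    exact key.symm
  symm y hy a b := by
    rw [coordMetric_apply, coordMetric_apply]
    exact g.symm _ _ _
  pos y hy a ha := by
    rw [coordMetric_apply]
    refine g.pos _ _ fun h => ha ?_
    exact (isInvertible_chartSymmDeriv hy).injective (h.trans (map_zero _).symm)

/-- The coordinate change from the chart at `x₀` to the chart at `x₁`. -/
noncomputable def transition (x₀ x₁ : M) : E → E :=
  extChartAt 𝓘(ℝ, E) x₁ ∘ (extChartAt 𝓘(ℝ, E) x₀).symm

section Transition

variable {x₀ x₁ : M} {y : E} (hy : y ∈ (extChartAt 𝓘(ℝ, E) x₀).target)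
  (hy₁ : (extChartAt 𝓘(ℝ, E) x₀).symm y ∈ (extChartAt 𝓘(ℝ, E) x₁).source)
include hy hy₁

theorem contDiffAt_transition : ContDiffAt ℝ ∞ (transition x₀ x₁) y :=
  (((contMDiffAt_extChartAt' (by rwa [extChartAt_source] at hy₁)).comp y
    (contMDiffAt_extChartAt_symm hy) :
      ContMDiffAt 𝓘(ℝ, E) 𝓘(ℝ, E) ∞ (transition x₀ x₁) y)).contDiffAt

omit [IsManifold 𝓘(ℝ, E) ∞ M] in
theorem eventually_mem_source : ∀ᶠ u in 𝓝 y, u ∈ (extChartAt 𝓘(ℝ, E) x₀).target ∧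
    (extChartAt 𝓘(ℝ, E) x₀).symm u ∈ (extChartAt 𝓘(ℝ, E) x₁).source :=
  Filter.Eventually.and (extChartAt_target_mem_nhds_of_mem hy)
    ((continuousAt_extChartAt_symm'' hy) ((isOpen_extChartAt_source x₁).mem_nhds hy₁))

theorem chartSymmDeriv_comp_fderiv_transition :
    (chartSymmDeriv x₁ (transition x₀ x₁ y)).comp (fderiv ℝ (transition x₀ x₁) y) =
      chartSymmDeriv x₀ y := by
  have hτy : transition x₀ x₁ y ∈ (extChartAt 𝓘(ℝ, E) x₁).target :=
    (extChartAt 𝓘(ℝ, E) x₁).map_source hy₁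
  have h1 : MDifferentiableAt 𝓘(ℝ, E) 𝓘(ℝ, E) (extChartAt 𝓘(ℝ, E) x₁).symm
      (transition x₀ x₁ y) := (contMDiffAt_extChartAt_symm hτy).mdifferentiableAt (by simp)
  have h2 : MDifferentiableAt 𝓘(ℝ, E) 𝓘(ℝ, E) (transition x₀ x₁) y :=
    ((contDiffAt_transition hy hy₁).differentiableAt (by simp)).mdifferentiableAt
  have h3 := mfderiv_comp y h1 h2
  have h4 : (extChartAt 𝓘(ℝ, E) x₁).symm ∘ transition x₀ x₁ =ᶠ[𝓝 y]
      (extChartAt 𝓘(ℝ, E) x₀).symm := by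
    filter_upwards [eventually_mem_source hy hy₁] with u hu
      using (extChartAt 𝓘(ℝ, E) x₁).left_inv hu.2
  rw [h4.mfderiv_eq, mfderiv_eq_fderiv] at h3
  exact h3.symm

theorem surjective_fderiv_transition :
    Function.Surjective (fderiv ℝ (transition x₀ x₁) y) := by
  intro c
  have hτy : transition x₀ x₁ y ∈ (extChartAt 𝓘(ℝ, E) x₁).target :=
    (extChartAt 𝓘(ℝ, E) x₁).map_source hy₁
  obtain ⟨a, ha⟩ := (isInvertible_chartSymmDeriv hy).surjective
    (chartSymmDeriv x₁ (transition x₀ x₁ y) c)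
  refine ⟨a, (isInvertible_chartSymmDeriv hτy).injective ?_⟩
  rw [← ha, ← chartSymmDeriv_comp_fderiv_transition hy hy₁]
  rfl

/-- The chart expressions of the metric are pulled back to each other by coordinate changes. -/
theorem coordMetric_transition (g : Metric E M) (a b : E) :
    coordMetric g x₀ y a b = coordMetric g x₁ (transition x₀ x₁ y)
      (fderiv ℝ (transition x₀ x₁) y a) (fderiv ℝ (transition x₀ x₁) y b) := by
  have h : (extChartAt 𝓘(ℝ, E) x₁).symm (transition x₀ x₁ y) =
    (extChartAt 𝓘(ℝ, E) x₀).symm y := (extChartAt 𝓘(ℝ, E) x₁).left_inv hy₁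
  rw [coordMetric_apply, coordMetric_apply, h, ← chartSymmDeriv_comp_fderiv_transition hy hy₁]
  rfl

end Transition

/-! ### The charts of the cotangent bundle -/

theorem mem_extChartAt_cotangent_source {p q : Cotangent E M} :
    q ∈ (extChartAt (cotModel E) p).source ↔ q.1 ∈ (extChartAt 𝓘(ℝ, E) p.1).source := by
  rw [extChartAt_source, extChartAt_source, FiberBundle.chartedSpace_chartAt]
  simp
  exact id

/-- The covector part of a point of `T*M`, with the tangent space identified with `E`. -/
def covector (q : Cotangent E M) : E →L[ℝ] ℝ := q.2

/-- The chart of `T*M` induced from a chart of `M`. -/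
theorem extChartAt_cotangent_apply {p q : Cotangent E M}
    (h : q.1 ∈ (extChartAt 𝓘(ℝ, E) p.1).source) :
    extChartAt (cotModel E) p q = (extChartAt 𝓘(ℝ, E) p.1 q.1,
      (covector q).comp (chartSymmDeriv p.1 (extChartAt 𝓘(ℝ, E) p.1 q.1))) := by
  rw [← symmL_trivializationAt_eq h, FiberBundle.extChartAt]
  refine Prod.ext ?_ (ContinuousLinearMap.ext fun c => ?_)
  · rfl
  · simp [hom_trivializationAt_apply, ContinuousLinearMap.inCoordinates]
    rfl

/-- The inner product on the tangent space at `x`, with the tangent space identified with `E`. -/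
def innerAt (g : Metric E M) (x : M) : E →L[ℝ] E →L[ℝ] ℝ := g.inner x

/-- The energy density computed in a chart. -/
theorem coordEnergy_extChartAt [FiniteDimensional ℝ E] (g : Metric E M) {p q : Cotangent E M}
    (h : q.1 ∈ (extChartAt 𝓘(ℝ, E) p.1).source) :
    coordEnergy (coordMetric g p.1 (extChartAt (cotModel E) p q).1) (extChartAt (cotModel E) p q).2
      = energy g q := by
  have hy := (extChartAt 𝓘(ℝ, E) p.1).map_source h
  have hinv : (innerAt g q.1).IsInvertible := isInvertible_of_pos fun a ha => g.pos q.1 a ha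
  rw [extChartAt_cotangent_apply h]
  refine (coordEnergy_comp (q := covector q) ((isLocalMetric_coordMetric g p.1).isInvertible hy)
    hinv (isInvertible_chartSymmDeriv hy).surjective (fun a b => ?_) rfl)
  rw [coordMetric_apply, (extChartAt 𝓘(ℝ, E) p.1).left_inv h]
  rfl

theorem mem_localTube_iff [FiniteDimensional ℝ E] (g : Metric E M) {ρ : EReal}
    {p q : Cotangent E M} (h : q ∈ (extChartAt (cotModel E) p).source) :
    extChartAt (cotModel E) p q ∈ localTube (coordMetric g p.1) (extChartAt 𝓘(ℝ, E) p.1).target ρ ↔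
      q ∈ tube g ρ := by
  rw [mem_extChartAt_cotangent_source] at h
  rw [localTube, Set.mem_ofPred_eq, coordEnergy_extChartAt g h, extChartAt_cotangent_apply h]
  exact and_iff_right ((extChartAt 𝓘(ℝ, E) p.1).map_source h)

theorem tube_mem_nhds [FiniteDimensional ℝ E] (g : Metric E M) {ρ : EReal} {p : Cotangent E M}
    (hp : p ∈ tube g ρ) : tube g ρ ∈ 𝓝 p := by
  have h := (mem_localTube_iff g (mem_extChartAt_source (I := cotModel E) p)).2 hp
  filter_upwards [extChartAt_source_mem_nhds (I := cotModel E) p,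
    (continuousAt_extChartAt (I := cotModel E) p)
      ((isLocalMetric_coordMetric g p.1).isOpen_localTube.mem_nhds h)] with q h1 h2
    using (mem_localTube_iff g h1).1 h2

theorem isOpen_tube [FiniteDimensional ℝ E] (g : Metric E M) (ρ : EReal) : IsOpen (tube g ρ) :=
  isOpen_iff_mem_nhds.2 fun _ hp => tube_mem_nhds g hp

/-! ### The almost complex structure in a fixed chart -/

/-- The derivative at `q` of the chart of `T*M` centred at `p`, as a map to the model space. -/
noncomputable def cotChartDeriv (p q : Cotangent E M) :
    TangentSpace (cotModel E) q →L[ℝ] E × (E →L[ℝ] ℝ) :=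
  mfderiv (cotModel E) 𝓘(ℝ, E × (E →L[ℝ] ℝ)) (extChartAt (cotModel E) p) q

theorem isInvertible_cotChartDeriv {p q : Cotangent E M}
    (h : q ∈ (extChartAt (cotModel E) p).source) : (cotChartDeriv p q).IsInvertible :=
  isInvertible_mfderiv_extChartAt (I := cotModel E) h

/-- The coordinate change of `T*M` from the chart at `p` to the chart at `p₀`. -/
noncomputable def cotTransition (p p₀ : Cotangent E M) : E × (E →L[ℝ] ℝ) → E × (E →L[ℝ] ℝ) :=
  extChartAt (cotModel E) p₀ ∘ (extChartAt (cotModel E) p).symm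

section Transition

variable {p₀ p q : Cotangent E M} (h : q ∈ (extChartAt (cotModel E) p).source)
  (h₀ : q ∈ (extChartAt (cotModel E) p₀).source)
include h h₀

theorem differentiableAt_cotTransition :
    DifferentiableAt ℝ (cotTransition p p₀) (extChartAt (cotModel E) p q) := by
  have hy := (extChartAt (cotModel E) p).map_source h
  have h1 : ContMDiffAt 𝓘(ℝ, E × (E →L[ℝ] ℝ)) (cotModel E) ∞ (extChartAt (cotModel E) p).symm
      (extChartAt (cotModel E) p q) :=
    (contMDiffOn_extChartAt_symm p).contMDiffAt ((isOpen_extChartAt_target p).mem_nhds hy)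
  have h2 : ContMDiffAt (cotModel E) 𝓘(ℝ, E × (E →L[ℝ] ℝ)) ∞ (extChartAt (cotModel E) p₀)
      ((extChartAt (cotModel E) p).symm (extChartAt (cotModel E) p q)) := by
    rw [(extChartAt (cotModel E) p).left_inv h]
    exact contMDiffAt_extChartAt' (by rwa [extChartAt_source] at h₀)
  exact ((h2.comp _ h1).contDiffAt).differentiableAt (by simp)

theorem fderiv_cotTransition_comp :
    (fderiv ℝ (cotTransition p p₀) (extChartAt (cotModel E) p q)).comp (cotChartDeriv p q) =
      cotChartDeriv p₀ q := by
  have h1 : MDifferentiableAt (cotModel E) 𝓘(ℝ, E × (E →L[ℝ] ℝ)) (extChartAt (cotModel E) p) q :=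
    mdifferentiableAt_extChartAt (by rwa [extChartAt_source] at h)
  have h2 := mfderiv_comp q (differentiableAt_cotTransition h h₀).mdifferentiableAt h1
  have h4 : cotTransition p p₀ ∘ extChartAt (cotModel E) p =ᶠ[𝓝 q] extChartAt (cotModel E) p₀ := by
    filter_upwards [(isOpen_extChartAt_source p).mem_nhds h] with u hu
    exact congrArg (extChartAt (cotModel E) p₀) ((extChartAt (cotModel E) p).left_inv hu)
  rw [h4.mfderiv_eq, mfderiv_eq_fderiv] at h2
  exact h2.symm

/-- In terms of the base coordinate change `τ`, the coordinate change of `T*M` is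
`(q, p) ↦ (τ q, p ∘ (dτ)⁻¹)`. -/
theorem cotTransition_eventually : ∀ᶠ u in 𝓝 (extChartAt (cotModel E) p q),
    (cotTransition p p₀ u).1 = transition p.1 p₀.1 u.1 ∧
      (cotTransition p p₀ u).2.comp (fderiv ℝ (transition p.1 p₀.1) u.1) = u.2 := by
  have hy := (extChartAt (cotModel E) p).map_source h
  filter_upwards [(isOpen_extChartAt_target (I := cotModel E) p).mem_nhds hy,
    (continuousAt_extChartAt_symm' h) (by
      rw [(extChartAt (cotModel E) p).left_inv h]
      exact (isOpen_extChartAt_source (I := cotModel E) p₀).mem_nhds h₀)] with u hu hu₀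
  obtain ⟨r, hr, rfl⟩ : ∃ r ∈ (extChartAt (cotModel E) p).source, extChartAt (cotModel E) p r = u :=
    ⟨_, (extChartAt (cotModel E) p).map_target hu, (extChartAt (cotModel E) p).right_inv hu⟩
  rw [Set.mem_preimage, (extChartAt (cotModel E) p).left_inv hr] at hu₀
  have e : cotTransition p p₀ (extChartAt (cotModel E) p r) = extChartAt (cotModel E) p₀ r :=
    congrArg (extChartAt (cotModel E) p₀) ((extChartAt (cotModel E) p).left_inv hr)
  rw [e]
  rw [mem_extChartAt_cotangent_source] at hr hu₀
  have e' : transition p.1 p₀.1 (extChartAt 𝓘(ℝ, E) p.1 r.1) = extChartAt 𝓘(ℝ, E) p₀.1 r.1 :=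
    congrArg (extChartAt 𝓘(ℝ, E) p₀.1) ((extChartAt 𝓘(ℝ, E) p.1).left_inv hr)
  rw [extChartAt_cotangent_apply hr, extChartAt_cotangent_apply hu₀]
  refine ⟨e'.symm, ?_⟩
  have hc := chartSymmDeriv_comp_fderiv_transition (x₁ := p₀.1)
    ((extChartAt 𝓘(ℝ, E) p.1).map_source hr)
    (by rwa [(extChartAt 𝓘(ℝ, E) p.1).left_inv hr])
  rw [e'] at hc
  simp only
  rw [← hc]
  rfl

end Transition

section FiniteDimensional

variable [FiniteDimensional ℝ E]

/-- Near `p₀`, the almost complex structure `J` has the coordinate expression `coordJ` in the fixed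
chart at `p₀`, although it is defined at each point through the chart at that point. -/
theorem cotChartDeriv_J (g : Metric E M) {ρ : EReal} {A : ℝ} {v : ℝ → ℝ} (hv : IsProfile A v ρ)
    {p₀ q : Cotangent E M} (h₀ : q ∈ (extChartAt (cotModel E) p₀).source) (hq : q ∈ tube g ρ)
    (w : TangentSpace (cotModel E) q) :
    cotChartDeriv p₀ q (J g A v q w) =
      coordJ A v (coordMetric g p₀.1) (extChartAt (cotModel E) p₀ q) (cotChartDeriv p₀ q w) := by
  have h := mem_extChartAt_source (I := cotModel E) q
  have hb := mem_extChartAt_cotangent_source.1 h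
  have hb₀ := mem_extChartAt_cotangent_source.1 h₀
  have hz := (mem_localTube_iff g h).2 hq
  have hz1 : (extChartAt (cotModel E) q q).1 = extChartAt 𝓘(ℝ, E) q.1 q.1 :=
    congrArg Prod.fst (extChartAt_cotangent_apply hb)
  have hy := (extChartAt 𝓘(ℝ, E) q.1).map_source hb
  have hy₁ : (extChartAt 𝓘(ℝ, E) q.1).symm (extChartAt 𝓘(ℝ, E) q.1 q.1) ∈
      (extChartAt 𝓘(ℝ, E) p₀.1).source := by
    rwa [(extChartAt 𝓘(ℝ, E) q.1).left_inv hb]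
  have hT := cotTransition_eventually h h₀
  have e : cotTransition q p₀ (extChartAt (cotModel E) q q) = extChartAt (cotModel E) p₀ q :=
    congrArg (extChartAt (cotModel E) p₀) ((extChartAt (cotModel E) q).left_inv h)
  have hJ : cotChartDeriv q q (J g A v q w) =
      coordJ A v (coordMetric g q.1) (extChartAt (cotModel E) q q) (cotChartDeriv q q w) :=
    (isInvertible_cotChartDeriv h).self_apply_inverse _
  have hnat := coordJ_natural hv (isLocalMetric_coordMetric g q.1)
    (isLocalMetric_coordMetric g p₀.1) (τ := transition q.1 p₀.1) (T := cotTransition q p₀) hz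
    (by rw [hz1]; exact (extChartAt 𝓘(ℝ, E) p₀.1).map_source hy₁)
    (by rw [hz1]; exact contDiffAt_transition hy hy₁)
    (differentiableAt_cotTransition h h₀)
    (by rw [hz1]; exact surjective_fderiv_transition hy hy₁)
    (by
      rw [hz1]
      filter_upwards [eventually_mem_source hy hy₁] with u hu a b
        using coordMetric_transition hu.1 hu.2 g a b)
    (hT.mono fun _ hu => hu.1) (hT.mono fun _ hu => hu.2) (cotChartDeriv q q w)
  rw [← fderiv_cotTransition_comp h h₀, ContinuousLinearMap.comp_apply, hJ, hnat, e]
  rfl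

end FiniteDimensional

/-! ### The Nijenhuis tensor in a chart -/

/-- The expression of a vector field on `T*M` in the chart at `p`. -/
noncomputable def chartField (p : Cotangent E M)
    (V : ∀ q : Cotangent E M, TangentSpace (cotModel E) q) :
    E × (E →L[ℝ] ℝ) → E × (E →L[ℝ] ℝ) :=
  mpullbackWithin 𝓘(ℝ, E × (E →L[ℝ] ℝ)) (cotModel E) (extChartAt (cotModel E) p).symm V
    (Set.range (cotModel E))

omit [IsManifold 𝓘(ℝ, E) ∞ M] in
theorem range_cotModel : Set.range (cotModel E) = Set.univ := by
  simp [cotModel]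

theorem chartField_apply {p q : Cotangent E M} (h : q ∈ (extChartAt (cotModel E) p).source)
    (V : ∀ q : Cotangent E M, TangentSpace (cotModel E) q) :
    chartField p V (extChartAt (cotModel E) p q) = cotChartDeriv p q (V q) := by
  have key : ∀ u ∈ (extChartAt (cotModel E) p).target, chartField p V u =
      cotChartDeriv p ((extChartAt (cotModel E) p).symm u)
        (V ((extChartAt (cotModel E) p).symm u)) := by
    intro u hu
    have h1 := mfderiv_extChartAt_comp_mfderivWithin_extChartAt_symm (I := cotModel E) hu
    have h2 := isInvertible_mfderivWithin_extChartAt_symm (I := cotModel E) hu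
    have h3 := congrArg (fun L => L ((mfderivWithin 𝓘(ℝ, E × (E →L[ℝ] ℝ)) (cotModel E)
      (extChartAt (cotModel E) p).symm (Set.range (cotModel E)) u).inverse
        (V ((extChartAt (cotModel E) p).symm u)))) h1
    simp only [ContinuousLinearMap.comp_apply, h2.self_apply_inverse] at h3
    exact h3.symm
  have h' := key _ ((extChartAt (cotModel E) p).map_source h)
  rwa [(extChartAt (cotModel E) p).left_inv h] at h'

/-- The Lie bracket of vector fields on `T*M`, computed in a chart. -/
theorem cotChartDeriv_mlieBracket (p : Cotangent E M)
    (V W : ∀ q : Cotangent E M, TangentSpace (cotModel E) q) :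
    cotChartDeriv p p (mlieBracket (cotModel E) V W p) =
      lieBracket ℝ (chartField p V) (chartField p W) (extChartAt (cotModel E) p p) := by
  have h := (isInvertible_cotChartDeriv
    (mem_extChartAt_source (I := cotModel E) p)).self_apply_inverse
    (lieBracket ℝ (chartField p V) (chartField p W) (extChartAt (cotModel E) p p))
  have h2 : mlieBracket (cotModel E) V W p = (cotChartDeriv p p).inverse
      (lieBracketWithin ℝ (chartField p V) (chartField p W)
        ((extChartAt (cotModel E) p).symm ⁻¹' Set.univ ∩ Set.range (cotModel E))
        (extChartAt (cotModel E) p p)) := mlieBracketWithin_apply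
  rw [range_cotModel, Set.preimage_univ, Set.univ_inter, lieBracketWithin_univ] at h2
  rw [h2, h]

section FiniteDimensional

variable [FiniteDimensional ℝ E]

theorem differentiableAt_chartField {p : Cotangent E M}
    {V : ∀ q : Cotangent E M, TangentSpace (cotModel E) q}
    {U : Set (Cotangent E M)} (hU : IsOpen U) (hp : p ∈ U)
    (hV : ContMDiffOn (cotModel E) (cotModel E).tangent ∞
      (fun q => (⟨q, V q⟩ : TangentBundle (cotModel E) (Cotangent E M))) U) :
    DifferentiableAt ℝ (chartField p V) (extChartAt (cotModel E) p p) := by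
  have := FiniteDimensional.complete ℝ (E × (E →L[ℝ] ℝ))
  have hm := ((hV.contMDiffAt (hU.mem_nhds hp)).mdifferentiableAt
    (by simp)).mdifferentiableWithinAt (s := Set.univ)
  have h : DifferentiableWithinAt ℝ (chartField p V)
      ((extChartAt (cotModel E) p).symm ⁻¹' Set.univ ∩ Set.range (cotModel E))
      (extChartAt (cotModel E) p p) :=
    MDifferentiableWithinAt.differentiableWithinAt_mpullbackWithin_vectorField hm
  rwa [Set.preimage_univ, Set.univ_inter, range_cotModel, differentiableWithinAt_univ] at h

/-- In the chart at `p`, the Nijenhuis tensor of `J` at `p` is that of `coordJ`. -/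
theorem cotChartDeriv_nijenhuis (g : Metric E M) {ρ : EReal} {A : ℝ} {v : ℝ → ℝ}
    (hv : IsProfile A v ρ) {U : Set (Cotangent E M)} (hU : IsOpen U) (hUt : U ⊆ tube g ρ)
    {X Y : ∀ q : Cotangent E M, TangentSpace (cotModel E) q}
    (hX : ContMDiffOn (cotModel E) (cotModel E).tangent ∞
      (fun q => (⟨q, X q⟩ : TangentBundle (cotModel E) (Cotangent E M))) U)
    (hY : ContMDiffOn (cotModel E) (cotModel E).tangent ∞
      (fun q => (⟨q, Y q⟩ : TangentBundle (cotModel E) (Cotangent E M))) U)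
    {p : Cotangent E M} (hp : p ∈ U) :
    cotChartDeriv p p (nijenhuis (cotModel E) (J g A v) X Y p) =
      nijenhuisTensor (coordJ A v (coordMetric g p.1)) (extChartAt (cotModel E) p p)
        (cotChartDeriv p p (X p)) (cotChartDeriv p p (Y p)) := by
  have hs := mem_extChartAt_source (I := cotModel E) p
  have hz := (mem_localTube_iff g hs).2 (hUt hp)
  have hγ := isLocalMetric_coordMetric g p.1
  have hJ : ∀ V : ∀ q : Cotangent E M, TangentSpace (cotModel E) q,
      chartField p (fun q => J g A v q (V q)) =ᶠ[𝓝 (extChartAt (cotModel E) p p)]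
        fun u => coordJ A v (coordMetric g p.1) u (chartField p V u) := by
    intro V
    have hy := (extChartAt (cotModel E) p).map_source hs
    filter_upwards [(isOpen_extChartAt_target (I := cotModel E) p).mem_nhds hy,
      hγ.isOpen_localTube.mem_nhds hz] with u hu hut
    obtain ⟨q, hq, rfl⟩ : ∃ q ∈ (extChartAt (cotModel E) p).source,
        extChartAt (cotModel E) p q = u :=
      ⟨_, (extChartAt (cotModel E) p).map_target hu, (extChartAt (cotModel E) p).right_inv hu⟩
    rw [chartField_apply hq, chartField_apply hq]
    exact cotChartDeriv_J g hv hq ((mem_localTube_iff g hq).1 hut) _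
  have hJp := fun w => cotChartDeriv_J g hv hs (hUt hp) w
  have hN := nijenhuis_lieBracket_eq (hγ.differentiableAt_coordJ hv hz)
    (hγ.coordJ_sq_eventually hv hz).self_of_nhds (differentiableAt_chartField hU hp hX)
    (differentiableAt_chartField hU hp hY)
  rw [chartField_apply hs, chartField_apply hs] at hN
  have hsub : ∀ a b : TangentSpace (cotModel E) p, cotChartDeriv p p (a - b) =
    cotChartDeriv p p a - cotChartDeriv p p b := fun a b => map_sub (cotChartDeriv p p) a b
  rw [← hN, nijenhuis, hsub, hsub, hsub]
  have e1 : cotChartDeriv p p (J g A v p (mlieBracket (cotModel E)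
      (fun q => J g A v q (X q)) Y p)) = _ := hJp _
  have e2 : cotChartDeriv p p (J g A v p (mlieBracket (cotModel E)
      X (fun q => J g A v q (Y q)) p)) = _ := hJp _
  rw [e1, e2, cotChartDeriv_mlieBracket, cotChartDeriv_mlieBracket, cotChartDeriv_mlieBracket,
    cotChartDeriv_mlieBracket, (hJ X).lieBracket_vectorField_eq (hJ Y),
    (hJ X).lieBracket_vectorField_eq EventuallyEq.rfl,
    EventuallyEq.rfl.lieBracket_vectorField_eq (hJ Y)]

omit [FiniteDimensional ℝ E] in
/-- A tangent vector of `T*M` at `p` extends to a smooth vector field near `p`. -/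
theorem exists_smooth_field (p : Cotangent E M) (x : E × (E →L[ℝ] ℝ)) :
    ∃ X : ∀ q : Cotangent E M, TangentSpace (cotModel E) q,
      ContMDiffOn (cotModel E) (cotModel E).tangent ∞
        (fun q => (⟨q, X q⟩ : TangentBundle (cotModel E) (Cotangent E M)))
        (extChartAt (cotModel E) p).source ∧ cotChartDeriv p p (X p) = x := by
  set e := trivializationAt (E × (E →L[ℝ] ℝ))
    (TangentSpace (cotModel E) : Cotangent E M → Type _) p with he
  have hb : e.baseSet = (extChartAt (cotModel E) p).source := by
    rw [he, TangentBundle.trivializationAt_baseSet, extChartAt_source]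
  refine ⟨fun q => e.symm q x, ?_, ?_⟩
  · rw [← hb]
    refine e.contMDiffOn_section_baseSet_iff.2 ?_
    refine (contMDiffOn_const (c := x)).congr fun q hq => ?_
    rw [e.apply_mk_symm hq]
  · have h1 := TangentBundle.continuousLinearMapAt_trivializationAt (I := cotModel E) (x₀ := p)
      (x := p) (mem_chart_source _ p)
    have hpb : p ∈ e.baseSet := by
      rw [hb]
      exact mem_extChartAt_source p
    have h2 := e.continuousLinearMapAt_symmL (R := ℝ) hpb x
    rw [e.symmL_apply (R := ℝ) hpb, h1] at h2
    exact h2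

/-- `J` is integrable on the tube if and only if its local expressions have vanishing Nijenhuis
tensor. -/
theorem isIntegrableOn_iff (g : Metric E M) {ρ : EReal} {A : ℝ} {v : ℝ → ℝ}
    (hv : IsProfile A v ρ) :
    IsIntegrableOn (cotModel E) (J g A v) (tube g ρ) ↔ ∀ p ∈ tube g ρ, ∀ x y,
      nijenhuisTensor (coordJ A v (coordMetric g p.1)) (extChartAt (cotModel E) p p) x y = 0 := by
  constructor
  · intro h p hp x y
    obtain ⟨X, hX, rfl⟩ := exists_smooth_field p x
    obtain ⟨Y, hY, rfl⟩ := exists_smooth_field p y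
    have hU : IsOpen ((extChartAt (cotModel E) p).source ∩ tube g ρ) :=
      (isOpen_extChartAt_source p).inter (isOpen_tube g ρ)
    have hpU := Set.mem_inter (mem_extChartAt_source (I := cotModel E) p) hp
    rw [← cotChartDeriv_nijenhuis g hv hU Set.inter_subset_right (hX.mono Set.inter_subset_left)
      (hY.mono Set.inter_subset_left) hpU,
      h _ hU Set.inter_subset_right X Y (hX.mono Set.inter_subset_left)
      (hY.mono Set.inter_subset_left) p hpU]
    exact map_zero (cotChartDeriv p p)
  · intro h U hU hUt X Y hX hY p hp
    refine (isInvertible_cotChartDeriv (mem_extChartAt_source (I := cotModel E) p)).injective ?_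
    refine Eq.trans ?_ (map_zero (cotChartDeriv p p)).symm
    exact (cotChartDeriv_nijenhuis g hv hU hUt hX hY hp).trans (h p (hUt hp) _ _)

end FiniteDimensional

/-! ### Consequences of the curvature identity on a cotangent space -/

theorem coordEnergy_smul_apply {β : E →L[ℝ] E →L[ℝ] ℝ} (hβ : β.IsInvertible) (r : ℝ) (d : E) :
    coordEnergy β (r • β d) = 1 / 2 * r ^ 2 * β d d := by
  rw [coordEnergy, ← map_smul β r d, hβ.inverse_apply_self]
  simp
  ring

section Pointwise

variable [FiniteDimensional ℝ E] {β : E →L[ℝ] E →L[ℝ] ℝ} (hsymm : ∀ a b, β a b = β b a)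
  (hpos : ∀ a, a ≠ 0 → 0 < β a a) {ρ : EReal} {A : ℝ} {v : ℝ → ℝ} (hv : IsProfile A v ρ)
  {R : E → E → E → E}
  (hR : ∀ p : E →L[ℝ] ℝ, (coordEnergy β p : EReal) < ρ → ∀ a b c,
    p (R a b c) = A * v (coordEnergy β p) * (p b * β a c - p a * β b c))
include hpos hv hR

/-- The left-hand side of the curvature identity is linear in `p`, so that `v(t)` does not change
when `p` is rescaled: `v` is constant. -/
theorem profile_const (hn : 2 ≤ Module.finrank ℝ E) (hρ : 0 < ρ) :
    ∀ t : ℝ, 0 ≤ t → (t : EReal) < ρ → v t = v 0 := by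
  have hβ := isInvertible_of_pos hpos
  have : Nontrivial E := Module.nontrivial_of_finrank_pos (R := ℝ) (by omega)
  obtain ⟨b, hb⟩ := exists_ne (0 : E)
  -- a nonzero vector orthogonal to `b`
  obtain ⟨a, ha, hba⟩ : ∃ a, a ≠ 0 ∧ β b a = 0 := by
    have h1 := (β b : E →ₗ[ℝ] ℝ).finrank_range_add_finrank_ker
    have h2 := Submodule.finrank_le (LinearMap.range (β b : E →ₗ[ℝ] ℝ))
    rw [Module.finrank_self] at h2
    obtain ⟨a, ha, hne⟩ := Submodule.exists_mem_ne_zero_of_ne_bot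
      (p := LinearMap.ker (β b : E →ₗ[ℝ] ℝ)) (by
        intro h
        rw [h, finrank_bot] at h1
        omega)
    exact ⟨a, hne, ha⟩
  have hbb := hpos b hb
  have haa := hpos a ha
  have hA := hv.ne_zero
  have hconst : ∀ t : ℝ, 0 < t → (t : EReal) < ρ → v t = β b (R a b a) / (A * β b b * β a a) := by
    intro t ht htρ
    set s := √(2 * t / β b b) with hs
    have hs0 : 0 < s := Real.sqrt_pos.2 (by positivity)
    have he : coordEnergy β (s • β b) = t := by
      rw [coordEnergy_smul_apply hβ, hs, Real.sq_sqrt (by positivity)]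
      field_simp
    have h := hR (s • β b) (by rwa [he]) a b a
    rw [he] at h
    simp only [smul_apply, smul_eq_mul, hba] at h
    rw [eq_div_iff (by positivity)]
    have : s * (v t * (A * β b b * β a a)) = s * β b (R a b a) := by linarith
    exact mul_left_cancel₀ hs0.ne' this
  -- the value at `0` is reached by continuity
  have hzero : v 0 = β b (R a b a) / (A * β b b * β a a) := by
    obtain ⟨ε, hε0, hερ⟩ := EReal.lt_iff_exists_real_btwn.1 hρ
    have hε : 0 < ε := by exact_mod_cast hε0
    have hc : ContinuousWithinAt v {t : ℝ | 0 ≤ t ∧ (t : EReal) < ρ} 0 :=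
      hv.contDiffOn.continuousOn 0 ⟨le_rfl, by exact_mod_cast hρ⟩
    have hlt : ∀ t : ℝ, t ∈ Set.Ioo 0 ε → (t : EReal) < ρ := fun t ht =>
      lt_trans (by exact_mod_cast ht.2) hερ
    have h1 : Tendsto v (𝓝[>] 0) (𝓝 (v 0)) := by
      rw [← nhdsWithin_Ioo_eq_nhdsGT hε]
      exact hc.mono fun t ht => ⟨ht.1.le, hlt t ht⟩
    have h2 : Tendsto v (𝓝[>] 0) (𝓝 (β b (R a b a) / (A * β b b * β a a))) := by
      refine tendsto_const_nhds.congr' ?_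
      filter_upwards [Ioo_mem_nhdsGT hε] with t ht using (hconst t ht.1 (hlt t ht)).symm
    exact tendsto_nhds_unique h1 h2
  intro t ht htρ
  rcases ht.eq_or_lt with rfl | ht
  · rfl
  · rw [hconst t ht htρ, hzero]

include hsymm in
/-- If the curvature identity holds on the tube, then `R` has the form of a curvature tensor of
constant curvature. -/
theorem curvature_eq_of_identity (hn : 2 ≤ Module.finrank ℝ E) (hρ : 0 < ρ) (a b c : E) :
    R a b c = (A * v 0) • (β a c • b - β b c • a) := by
  have hβ := isInvertible_of_pos hpos
  refine hβ.injective (ContinuousLinearMap.ext fun d => ?_)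
  rw [hsymm, hsymm _ d]
  obtain ⟨ε, hε0, hερ⟩ := EReal.lt_iff_exists_real_btwn.1 hρ
  have hε : 0 < ε := by exact_mod_cast hε0
  have hdd : 0 ≤ β d d := by
    rcases eq_or_ne d 0 with rfl | hd
    · simp
    · exact (hpos d hd).le
  -- a small positive multiple of the covector `g(d, ·)` lies in the tube
  set r := √(ε / (β d d + 1)) with hr
  have hr0 : 0 < r := Real.sqrt_pos.2 (by positivity)
  have he : coordEnergy β (r • β d) < ε := by
    rw [coordEnergy_smul_apply hβ, hr, Real.sq_sqrt (by positivity)]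
    rw [show 1 / 2 * (ε / (β d d + 1)) * β d d = (1 / 2 * ε * β d d) / (β d d + 1) by ring,
      div_lt_iff₀ (by positivity)]
    nlinarith
  have hlt : (coordEnergy β (r • β d) : EReal) < ρ := lt_trans (by exact_mod_cast he) hερ
  have h0 : 0 ≤ coordEnergy β (r • β d) := by
    rw [coordEnergy_smul_apply hβ]
    positivity
  have h := hR (r • β d) hlt a b c
  rw [profile_const hpos hv hR hn hρ _ h0 hlt] at h
  simp only [smul_apply, smul_eq_mul] at h
  simp only [map_smul, map_sub, smul_eq_mul]
  refine mul_left_cancel₀ hr0.ne' (h.trans ?_)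
  ring

end Pointwise

/-! ### Sectional curvature in a chart -/

/-- The Gram determinant of two independent vectors is positive. -/
theorem gram_pos {β : E →L[ℝ] E →L[ℝ] ℝ} (hsymm : ∀ a b, β a b = β b a)
    (hpos : ∀ a, a ≠ 0 → 0 < β a a) {a b : E} (h : LinearIndependent ℝ ![a, b]) :
    0 < β a a * β b b - β a b ^ 2 := by
  have hb : b ≠ 0 := h.ne_zero 1
  have hbb := hpos b hb
  have hw : β b b • a - β a b • b ≠ 0 := by
    intro h0
    have h1 := LinearIndependent.pair_iff.1 h (β b b) (-β a b)
      (by rw [neg_smul, ← sub_eq_add_neg, h0])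
    exact hbb.ne' h1.1
  have h1 := hpos _ hw
  simp only [map_sub, map_smul, sub_apply, smul_apply, smul_eq_mul, hsymm b a] at h1
  have h2 : 0 < β b b * (β a a * β b b - β a b ^ 2) := by linarith
  exact (mul_pos_iff_of_pos_left hbb).1 h2

theorem chartSymmDeriv_self (x : M) :
    chartSymmDeriv x (extChartAt 𝓘(ℝ, E) x x) = ContinuousLinearMap.id ℝ E := by
  have h := mfderivWithin_range_extChartAt_symm (I := 𝓘(ℝ, E)) (x := x)
  rw [modelWithCornersSelf_coe, Set.range_id, mfderivWithin_univ] at h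
  exact h

theorem innerAt_eq_coordMetric (g : Metric E M) (x : M) (a b : E) :
    innerAt g x a b = coordMetric g x (extChartAt 𝓘(ℝ, E) x x) a b := by
  rw [coordMetric_apply, (extChartAt 𝓘(ℝ, E) x).left_inv (mem_extChartAt_source x),
    chartSymmDeriv_self]
  rfl

theorem curvature_eq (g : Metric E M) (x : M) (a b c : E) :
    curvature g x a b c = coordCurvature (coordMetric g x) (extChartAt 𝓘(ℝ, E) x x) a b c := by
  have h := mfderiv_extChartAt_self (I := 𝓘(ℝ, E)) (x := x)
  have h' : curvature g x a b c = (ContinuousLinearMap.id ℝ E).inverse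
      (coordCurvature (coordMetric g x) (extChartAt 𝓘(ℝ, E) x x) a b c) := by
    simp only [curvature]
    rw [h]
    rfl
  rwa [ContinuousLinearMap.inverse_id] at h'

theorem sectionalCurvature_eq (g : Metric E M) (x : M) (a b : E) :
    sectionalCurvature g x a b =
      coordMetric g x (extChartAt 𝓘(ℝ, E) x x)
          (coordCurvature (coordMetric g x) (extChartAt 𝓘(ℝ, E) x x) a b b) a /
        (coordMetric g x (extChartAt 𝓘(ℝ, E) x x) a a * coordMetric g x (extChartAt 𝓘(ℝ, E) x x) b b
          - coordMetric g x (extChartAt 𝓘(ℝ, E) x x) a b ^ 2) := by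
  simp only [← innerAt_eq_coordMetric]
  rw [← curvature_eq]
  rfl

theorem hasConstantSectionalCurvature_iff [FiniteDimensional ℝ E] (g : Metric E M) (c : ℝ) :
    HasConstantSectionalCurvature g c ↔ ∀ (x : M) (a b d : E),
      coordCurvature (coordMetric g x) (extChartAt 𝓘(ℝ, E) x x) a b d =
        c • (coordMetric g x (extChartAt 𝓘(ℝ, E) x x) b d • a -
          coordMetric g x (extChartAt 𝓘(ℝ, E) x x) a d • b) := by
  have hγ := isLocalMetric_coordMetric g
  have hy := fun x : M => mem_extChartAt_target (I := 𝓘(ℝ, E)) x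
  constructor
  · intro h x
    refine (hγ x).coordCurvature_eq_of_sectional (hy x) fun a b hab => ?_
    have h1 := h x a b hab
    rw [sectionalCurvature_eq g x a b, div_eq_iff
      (gram_pos ((hγ x).symm _ (hy x)) ((hγ x).pos _ (hy x)) hab).ne'] at h1
    exact h1
  · intro h x (a : E) (b : E) hab
    have hpos := gram_pos (E := E) (a := a) (b := b) ((hγ x).symm _ (hy x))
      ((hγ x).pos _ (hy x)) hab
    rw [sectionalCurvature_eq g x a b, div_eq_iff hpos.ne', h x]
    simp only [map_smul, map_sub, smul_apply, sub_apply, smul_eq_mul]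
    rw [(hγ x).symm _ (hy x) b a]
    ring

/-! ### The curvature identity on the tube -/

/-- `J` is integrable if and only if the curvature identity holds at all covectors in the tube. -/
theorem isIntegrableOn_iff_curvature [FiniteDimensional ℝ E] (g : Metric E M) {ρ : EReal} {A : ℝ}
    {v : ℝ → ℝ} (hv : IsProfile A v ρ) :
    IsIntegrableOn (cotModel E) (J g A v) (tube g ρ) ↔ ∀ (x : M) (p : E →L[ℝ] ℝ),
      (coordEnergy (coordMetric g x (extChartAt 𝓘(ℝ, E) x x)) p : EReal) < ρ → ∀ a b c,
        p (coordCurvature (coordMetric g x) (extChartAt 𝓘(ℝ, E) x x) a b c) =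
          A * v (coordEnergy (coordMetric g x (extChartAt 𝓘(ℝ, E) x x)) p) *
            (p b * coordMetric g x (extChartAt 𝓘(ℝ, E) x x) a c -
              p a * coordMetric g x (extChartAt 𝓘(ℝ, E) x x) b c) := by
  have hfst : ∀ q : Cotangent E M,
      (extChartAt (cotModel E) q q).1 = extChartAt 𝓘(ℝ, E) q.1 q.1 := fun q =>
    congrArg Prod.fst (extChartAt_cotangent_apply (mem_extChartAt_source q.1))
  have key : ∀ q ∈ tube g ρ, _ := fun q hq =>
    (isLocalMetric_coordMetric g q.1).nijenhuisTensor_eq_zero_iff hv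
      ((mem_localTube_iff g (mem_extChartAt_source (I := cotModel E) q)).2 hq)
  rw [isIntegrableOn_iff g hv]
  constructor
  · intro h x p hp
    obtain ⟨q, rfl, rfl⟩ : ∃ q : Cotangent E M, q.1 = x ∧ (extChartAt (cotModel E) q q).2 = p := by
      obtain ⟨q, rfl, hq⟩ : ∃ q : Cotangent E M, q.1 = x ∧ covector q = p := ⟨⟨x, p⟩, rfl, rfl⟩
      refine ⟨q, rfl, ?_⟩
      rw [extChartAt_cotangent_apply (mem_extChartAt_source q.1), chartSymmDeriv_self, hq]
      rfl
    rw [← hfst q] at hp ⊢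
    have hq : q ∈ tube g ρ := (mem_localTube_iff g (mem_extChartAt_source (I := cotModel E) q)).1
      ⟨by rw [hfst q]; exact mem_extChartAt_target q.1, hp⟩
    exact (key q hq).1 (h q hq)
  · intro h q hq
    refine (key q hq).2 ?_
    rw [hfst q]
    have hlt := ((mem_localTube_iff g (mem_extChartAt_source (I := cotModel E) q)).2 hq).2
    rw [hfst q] at hlt
    exact h q.1 _ hlt

end CotangentACS

theorem theorem3
    {E : Type*} [NormedAddCommGroup E] [NormedSpace ℝ E] [FiniteDimensional ℝ E]
    (hn : 2 ≤ Module.finrank ℝ E)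
    {M : Type*} [TopologicalSpace M] [ChartedSpace E M] [IsManifold 𝓘(ℝ, E) ∞ M]
    [T2Space M] [SecondCountableTopology M] [Nonempty M]
    (g : CotangentACS.Metric E M)
    (A : ℝ) (hA : A ≠ 0) (ρ : EReal) (hρ : 0 < ρ)
    (v : ℝ → ℝ) (hv : ContDiffOn ℝ ∞ v {t : ℝ | 0 ≤ t ∧ (t : EReal) < ρ})
    (hG : ∀ t : ℝ, 0 ≤ t → (t : EReal) < ρ → A + 2 * t * v t ≠ 0) :
    CotangentACS.IsIntegrableOn (CotangentACS.cotModel E) (CotangentACS.J g A v)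
        (CotangentACS.tube g ρ) ↔
      ∃ c : ℝ, CotangentACS.HasConstantSectionalCurvature g c ∧
        ∀ t : ℝ, 0 ≤ t → (t : EReal) < ρ → v t = -c / A := by
  have hp : CotangentACS.IsProfile A v ρ := ⟨hA, hv, hG⟩
  have hγ := CotangentACS.isLocalMetric_coordMetric g
  have hy := fun x : M => mem_extChartAt_target (I := 𝓘(ℝ, E)) x
  rw [CotangentACS.isIntegrableOn_iff_curvature g hp]
  constructor
  · intro h
    refine ⟨-(A * v 0), ?_, ?_⟩
    · rw [CotangentACS.hasConstantSectionalCurvature_iff]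
      intro x a b d
      rw [CotangentACS.curvature_eq_of_identity ((hγ x).symm _ (hy x)) ((hγ x).pos _ (hy x)) hp
        (h x) hn hρ, neg_smul, ← smul_neg, neg_sub]
    · obtain ⟨x⟩ := ‹Nonempty M›
      intro t ht htρ
      rw [CotangentACS.profile_const ((hγ x).pos _ (hy x)) hp (h x) hn hρ t ht htρ]
      field_simp
  · rintro ⟨c, hc, hvc⟩ x p hlt a b d
    rw [CotangentACS.hasConstantSectionalCurvature_iff] at hc
    rw [hc x, hvc _ ((hγ x).coordEnergy_nonneg (hy x) p) hlt, mul_div_cancel₀ _ hA]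
    simp only [map_smul, map_sub, smul_eq_mul]
    ring
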